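/- **Weighted Rellich inequality.** Let $(M^n,g)$ be an $n$-dimensional smooth Riemannian manifold (Hausdorff, $\sigma$-compact, without boundary) with volume measure $dv_g$, let $u\in C^\infty(M)$, $V=e^{u}$, let $\lambda,\mu\in\mathbb R$ and $\tau=(n+1)\lambda+\mu$. Write $$\nabla^{D}f=V^{\mu-\lambda}\nabla f,\qquad \Delta^{D}f=V^{\mu-\lambda}\bigl[\Delta f+(2\mu+n\lambda)\langle\nabla u,\nabla f\rangle\bigr]$$ for the affine gradient and the affine Laplacian of the Riemannian triple $(M,g,V)$ with parameters $\lambda,\mu$, where $\nabla$, $\Delta$ are the gradient and the Laplace–Beltrami operator of $g$. Let $C,\alpha\in\mathbb R$ with $C>1$, $\alpha<2$ and $C+\alpha-3>0$. Let $\rho\ge 0$ be a continuous function on $M$ that satisfies, in the sense of distributions on the open set $M\setminus\rho^{-1}\{0\}$, $$|\nabla^{D}\rho|=1\qquad\text{and}\qquad \Delta^{D}\rho\ \ge\ \frac{C}{\rho}\,V^{\lambda-\mu};$$ that is, $\rho$ has a locally integrable weak gradient $\nabla\rho$ on $M\setminus\rho^{-1}\{0\}$ with $V^{\mu-\lambda}|\nabla\rho|=1$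 almost everywhere there, and $$-\int_M\langle\nabla\psi,\nabla^{D}\rho\rangle V^{\tau}\,dv_g\ \ge\ \int_M\frac{C}{\rho}\,V^{\lambda-\mu}\,\psi\,V^{\tau}\,dv_g\qquad\text{for all } 0\le\psi\in C_0^\infty(M\setminus\rho^{-1}\{0\}).$$ Then, for every $\varphi\in C_0^\infty(M\setminus\rho^{-1}\{0\})$, $$\int_M\rho^{\alpha}(\Delta^{D}\varphi)^2\,V^{\tau+\mu-\lambda}\,dv_g\ \ge\ \frac{(C+\alpha-3)^2(C-\alpha+1)^2}{16}\int_M\rho^{\alpha-4}\varphi^2\,V^{\tau+\lambda-\mu}\,dv_g .$$ -/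

import Mathlib

open Set MeasureTheory Bundle
open scoped Manifold ContDiff

noncomputable section

namespace AffineRellich

variable {n : ℕ} {M : Type*} [TopologicalSpace M]
  [ChartedSpace (EuclideanSpace ℝ (Fin n)) M] [IsManifold (𝓡 n) ∞ M]

/-- A smooth Riemannian metric on the `n`-dimensional smooth manifold `M` (without boundary). -/
abbrev Metric (n : ℕ) (M : Type*) [TopologicalSpace M]
    [ChartedSpace (EuclideanSpace ℝ (Fin n)) M] [IsManifold (𝓡 n) ∞ M] :=
  ContMDiffRiemannianMetric (𝓡 n) ∞ (EuclideanSpace ℝ (Fin n))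
    (fun x : M => TangentSpace (𝓡 n) x)

/-- The length `|v| = g(v, v)^{1/2}` of a tangent vector `v` at `x`. -/
def norm (g : Metric n M) (x : M) (v : TangentSpace (𝓡 n) x) : ℝ :=
  √(g.inner x v v)

/-- The metric at `x` as a bilinear form on the tangent space. -/
def form (g : Metric n M) (x : M) : LinearMap.BilinForm ℝ (TangentSpace (𝓡 n) x) :=
  LinearMap.mk₂ ℝ (fun v w => g.inner x v w)
    (fun v v' w => by simp) (fun c v w => by simp)
    (fun v w w' => by simp) (fun c v w => by simp)

theorem form_nondegenerate (g : Metric n M) (x : M) : (form g x).Nondegenerate := by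
  constructor
  · intro v hv
    by_contra h
    exact (g.pos x v h).ne' (hv v)
  · intro v hv
    by_contra h
    exact (g.pos x v h).ne' (hv v)

instance (x : M) : FiniteDimensional ℝ (TangentSpace (𝓡 n) x) :=
  inferInstanceAs (FiniteDimensional ℝ (EuclideanSpace ℝ (Fin n)))

/-- The gradient `∇f` of `f : M → ℝ`: the vector field with `g(∇f, v) = df(v)`. -/
def grad (g : Metric n M) (f : M → ℝ) (x : M) : TangentSpace (𝓡 n) x :=
  ((form g x).toDual (form_nondegenerate g x)).symm
    (mvfderiv (𝓡 n) f x).toLinearMap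

/-- The defining property of the gradient. -/
theorem inner_grad (g : Metric n M) (f : M → ℝ) (x : M) (v : TangentSpace (𝓡 n) x) :
    g.inner x (grad g f x) v = mvfderiv (𝓡 n) f x v :=
  LinearMap.BilinForm.apply_toDual_symm_apply (hB := form_nondegenerate g x) _ v

/-- The `i`-th standard basis vector of `ℝⁿ`. -/
abbrev e (i : Fin n) : EuclideanSpace ℝ (Fin n) := EuclideanSpace.single i 1

/-- The coordinate vector field `∂ᵢ` of the chart `c`, at the point with coordinates `y`. -/
def coordVec (c : OpenPartialHomeomorph M (EuclideanSpace ℝ (Fin n))) (i : Fin n)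
    (y : EuclideanSpace ℝ (Fin n)) : TangentSpace (𝓡 n) (c.symm y) :=
  mfderiv 𝓘(ℝ, EuclideanSpace ℝ (Fin n)) (𝓡 n) c.symm y
    ((NormedSpace.fromTangentSpace y).symm (e i))

/-- The `i`-th component `Xⁱ` of the vector field `X` in the chart `c`, as a function of the
coordinates `y`. -/
def coordComp (c : OpenPartialHomeomorph M (EuclideanSpace ℝ (Fin n)))
    (X : (x : M) → TangentSpace (𝓡 n) x) (i : Fin n) (y : EuclideanSpace ℝ (Fin n)) : ℝ :=
  mvfderiv (𝓡 n) c (c.symm y) (X (c.symm y)) i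

/-- The volume density `(det g_{ij})^{1/2}`, `g_{ij} = g(∂ᵢ, ∂ⱼ)`, in the chart `c`. -/
def volDensity (g : Metric n M) (c : OpenPartialHomeomorph M (EuclideanSpace ℝ (Fin n)))
    (y : EuclideanSpace ℝ (Fin n)) : ℝ :=
  √(Matrix.det (Matrix.of fun i j : Fin n =>
    g.inner (c.symm y) (coordVec c i y) (coordVec c j y)))

/-- The Riemannian divergence `(det g)^{-1/2} ∑ᵢ ∂ᵢ((det g)^{1/2} Xⁱ)` of a vector field,
computed at `x` in the preferred chart around `x`. -/
def div (g : Metric n M) (X : (x : M) → TangentSpace (𝓡 n) x) (x : M) : ℝ :=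
  let c := chartAt (EuclideanSpace ℝ (Fin n)) x
  (volDensity g c (c x))⁻¹ *
    ∑ i : Fin n, fderiv ℝ (fun y => volDensity g c y * coordComp c X i y) (c x) (e i)

/-- The Laplace-Beltrami operator `Δf = div ∇f`. -/
def laplacian (g : Metric n M) (f : M → ℝ) (x : M) : ℝ :=
  div g (grad g f) x

/-- The affine rescaling `V^{μ-λ} X` of a vector field `X`, where `V = e^u`; for `X = ∇f`, with
`∇f` classical or weak, it is the affine gradient of `f`. -/
def affineScale (u : M → ℝ) (lam mu : ℝ) (X : (x : M) → TangentSpace (𝓡 n) x) (x : M) :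
    TangentSpace (𝓡 n) x :=
  Real.exp (u x) ^ (mu - lam) • X x

/-- The affine Laplacian `V^{μ-λ} (Δf + (2μ + nλ) ⟨∇u, ∇f⟩)`, where `V = e^u`. -/
def affineLaplacian (g : Metric n M) (u : M → ℝ) (lam mu : ℝ) (f : M → ℝ) (x : M) : ℝ :=
  Real.exp (u x) ^ (mu - lam) *
    (laplacian g f x + (2 * mu + n * lam) * g.inner x (grad g u x) (grad g f x))

/-- `ψ ∈ C_0^∞(U)`. -/
structure IsTestFunctionOn (n : ℕ) {M : Type*} [TopologicalSpace M]
    [ChartedSpace (EuclideanSpace ℝ (Fin n)) M] (U : Set M) (ψ : M → ℝ) : Prop where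
  smooth : ContMDiff (𝓡 n) 𝓘(ℝ, ℝ) ∞ ψ
  compact_support : HasCompactSupport ψ
  support_subset : tsupport ψ ⊆ U

/-- The vector field `X` is the weak (distributional) gradient of `f` on the open set `U`: in
every chart, `f` and the functions `g(X, ∂ᵢ)` are locally integrable, and `g(X, ∂ᵢ)` is the weak
partial derivative `∂ᵢf`. -/
structure IsWeakGradientOn (g : Metric n M) (U : Set M) (f : M → ℝ)
    (X : (x : M) → TangentSpace (𝓡 n) x) : Prop where
  locallyIntegrable : ∀ p : M,
    let c := chartAt (EuclideanSpace ℝ (Fin n)) p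
    LocallyIntegrableOn (fun y => f (c.symm y)) (c.target ∩ c.symm ⁻¹' U) volume
  locallyIntegrable_grad : ∀ (p : M) (i : Fin n),
    let c := chartAt (EuclideanSpace ℝ (Fin n)) p
    LocallyIntegrableOn (fun y => g.inner (c.symm y) (X (c.symm y)) (coordVec c i y))
      (c.target ∩ c.symm ⁻¹' U) volume
  weak_deriv : ∀ (p : M) (i : Fin n) (ψ : EuclideanSpace ℝ (Fin n) → ℝ),
    let c := chartAt (EuclideanSpace ℝ (Fin n)) p
    ContDiff ℝ ∞ ψ → HasCompactSupport ψ → tsupport ψ ⊆ c.target ∩ c.symm ⁻¹' U →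
      ∫ y, f (c.symm y) * fderiv ℝ ψ y (e i) =
        - ∫ y, g.inner (c.symm y) (X (c.symm y)) (coordVec c i y) * ψ y

section Volume

variable [T2Space M] [SigmaCompactSpace M]

/-- A smooth partition of unity on `M` subordinate to the chart domains. -/
def chartPartition (n : ℕ) (M : Type*) [TopologicalSpace M]
    [ChartedSpace (EuclideanSpace ℝ (Fin n)) M] [IsManifold (𝓡 n) ∞ M]
    [T2Space M] [SigmaCompactSpace M] : SmoothPartitionOfUnity M (𝓡 n) M univ :=
  (SmoothPartitionOfUnity.exists_isSubordinate_chartAt_source (𝓡 n) M).choose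

theorem chartPartition_isSubordinate :
    (chartPartition n M).IsSubordinate
      (fun x => (chartAt (EuclideanSpace ℝ (Fin n)) x).source) :=
  (SmoothPartitionOfUnity.exists_isSubordinate_chartAt_source (𝓡 n) M).choose_spec

variable [MeasurableSpace M] [BorelSpace M]

/-- The measure `(det g)^{1/2} dy` of the chart `c`, carried over to `M`. -/
def chartVolume (g : Metric n M) (c : OpenPartialHomeomorph M (EuclideanSpace ℝ (Fin n))) :
    Measure M :=
  ((volume.restrict c.target).withDensity (fun y => ENNReal.ofReal (volDensity g c y))).map c.symm

/-- The Riemannian volume measure `dv_g`, put together from the charts by a partition of unity: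
`∫ f dv_g = ∑ₚ ∫ (χₚ f) ∘ cₚ⁻¹ (det g)^{1/2} dy`. -/
def riemannianVolume (g : Metric n M) : Measure M :=
  Measure.sum fun p : M =>
    (chartVolume g (chartAt (EuclideanSpace ℝ (Fin n)) p)).withDensity
      (fun x => ENNReal.ofReal (chartPartition n M p x))

/-- `Δ^D f ≥ h` in the sense of distributions on `U`, where `X` is the weak gradient of `f` on
`U`: for every nonnegative test function `ψ` on `U`,
`- ∫ ⟨∇ψ, ∇^D f⟩ V^τ dv_g ≥ ∫ h ψ V^τ dv_g`, with `τ = (n + 1) λ + μ`. -/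
def AffineLaplacianGEOn (g : Metric n M) (u : M → ℝ) (lam mu : ℝ) (U : Set M)
    (X : (x : M) → TangentSpace (𝓡 n) x) (h : M → ℝ) : Prop :=
  ∀ ψ : M → ℝ, IsTestFunctionOn n U ψ → (∀ x, 0 ≤ ψ x) →
    ∫ x, h x * ψ x * Real.exp (u x) ^ ((n + 1) * lam + mu) ∂(riemannianVolume g) ≤
      - ∫ x, g.inner x (grad g ψ x) (affineScale u lam mu X x) *
          Real.exp (u x) ^ ((n + 1) * lam + mu) ∂(riemannianVolume g)

end Volume

end AffineRellich

end

/-! With dm = V^τ dv_g, put P = ∫ ρ^{α-4} φ² V^{λ-μ} dm, E = ∫ ρ^{α-3} φ ⟨∇ρ, ∇φ⟩ V^{μ-λ} dm, B = ∫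
ρ^{α-2} |∇φ|² V^{μ-λ} dm, F = ∫ ρ^{α-2} φ Δ^Dφ dm and D = ∫ ρ^α (Δ^Dφ)² V^{μ-λ} dm. Let κ =
(C+α-3)/2 and θ = κ(κ+2-α), so that θ² is the constant of the theorem. The claim is D ≥ θ² P.

Testing Δ^Dρ ≥ (C/ρ) V^{λ-μ} with ρ^{α-3} φ² gives κP ≤ -E, because the eikonal equation turns
V^{μ-λ}|∇ρ|² into V^{λ-μ}. Integrating the square of ρ∇φ + κφ∇ρ against ρ^{α-4} gives B + 2κE + κ²P
≥ 0, hence the Hardy inequality B ≥ κ²P. Since Δ^D is a divergence with respect to dm, integration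
by parts gives F + (α-2)E + B = 0, so -F = B + (2-α)(-E) ≥ θP; here α < 2 is used. Finally the
square of ρ²Δ^Dφ + θφV^{λ-μ} gives D + 2θF + θ²P ≥ 0, hence D ≥ θ²P.

The labour lies in justifying the two integrations by parts, since ρ is only continuous with a weak
gradient and ρ^s η is not a smooth test function. The eikonal equation makes the gradient locally
bounded in charts (`IsWeakGradientOn.isBoundedWeakGradientOn`). Mollification then converges
uniformly, with boundedly a.e. convergent derivatives (`IsBoundedWeakGradientOn.exists_approx`), so
ρ^s η is admissible (`integral_rpow`, `integral_test_rpow`). A partition of unity carries this to M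
(`integral_affineLaplacian_test`, `integral_affineLaplacianGEOn_test`). This needs the volume and
the divergence to be independent of the chart (`riemannianVolume_restrict_source`, `divIn_eqOn`). -/

noncomputable section

namespace AffineRellich

/-! ### Vector fields, the metric and its density in coordinates. -/

section ChartCalculus

variable {n : ℕ} {M : Type*} [TopologicalSpace M]
  [ChartedSpace (EuclideanSpace ℝ (Fin n)) M] [IsManifold (𝓡 n) ∞ M]
  {c : OpenPartialHomeomorph M (EuclideanSpace ℝ (Fin n))}

theorem isManifold_one (n : ℕ) (M : Type*) [TopologicalSpace M]
    [ChartedSpace (EuclideanSpace ℝ (Fin n)) M] [IsManifold (𝓡 n) ∞ M] :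
    IsManifold (𝓡 n) 1 M :=
  IsManifold.of_le (n := ∞) (by norm_num)

theorem mdifferentiable_of_mem_atlas' (hc : c ∈ atlas (EuclideanSpace ℝ (Fin n)) M) :
    c.MDifferentiable (𝓡 n) (𝓡 n) :=
  haveI := isManifold_one n M
  mdifferentiable_of_mem_atlas hc

/-- The derivative of a function along a coordinate vector field is the partial derivative of its
coordinate expression. -/
theorem mvfderiv_coordVec {F : Type*} [NormedAddCommGroup F] [NormedSpace ℝ F]
    (hc : c ∈ atlas (EuclideanSpace ℝ (Fin n)) M) {y : EuclideanSpace ℝ (Fin n)}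
    (hy : y ∈ c.target) {f : M → F} (hf : MDifferentiableAt (𝓡 n) 𝓘(ℝ, F) f (c.symm y))
    (i : Fin n) :
    mvfderiv (𝓡 n) f (c.symm y) (coordVec c i y) = fderiv ℝ (fun z => f (c.symm z)) y (e i) := by
  have h1 := mfderiv_comp y hf ((mdifferentiable_of_mem_atlas' hc).mdifferentiableAt_symm hy)
  have h2 : fderiv ℝ (fun z => f (c.symm z)) y
      = mfderiv 𝓘(ℝ, EuclideanSpace ℝ (Fin n)) 𝓘(ℝ, F) (f ∘ c.symm) y := by
    rw [mfderiv_eq_fderiv]; rfl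
  rw [h2, h1]
  rfl

theorem mvfderiv_chart_coordVec (hc : c ∈ atlas (EuclideanSpace ℝ (Fin n)) M)
    {y : EuclideanSpace ℝ (Fin n)} (hy : y ∈ c.target) (i : Fin n) :
    mvfderiv (𝓡 n) c (c.symm y) (coordVec c i y) = e i := by
  have hd := (mdifferentiable_of_mem_atlas' hc)
  rw [mvfderiv_coordVec hc hy (hd.mdifferentiableAt (c.map_target hy))]
  have : (fun z => c (c.symm z)) =ᶠ[nhds y] id := by
    filter_upwards [c.open_target.mem_nhds hy] with z hz using c.right_inv hz
  rw [this.fderiv_eq, fderiv_id]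
  rfl

theorem mvfderiv_chart_injective (hc : c ∈ atlas (EuclideanSpace ℝ (Fin n)) M) {x : M}
    (hx : x ∈ c.source) : Function.Injective (mvfderiv (𝓡 n) c x) :=
  (mdifferentiable_of_mem_atlas' hc).mfderiv_injective hx

/-- The differential of the chart is injective and sends the coordinate fields to the standard
basis, so both sides may be compared after applying it. -/
theorem eq_sum_coordVec (hc : c ∈ atlas (EuclideanSpace ℝ (Fin n)) M)
    {y : EuclideanSpace ℝ (Fin n)} (hy : y ∈ c.target) (v : TangentSpace (𝓡 n) (c.symm y)) :
    v = ∑ i, mvfderiv (𝓡 n) c (c.symm y) v i • coordVec c i y := by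
  apply mvfderiv_chart_injective hc (c.map_target hy)
  rw [map_sum]
  simp only [map_smul, mvfderiv_chart_coordVec hc hy]
  ext j
  simp [Finset.sum_apply, Pi.single_apply]

/-- The derivative of `f` along `v` in terms of coordinates. -/
theorem mvfderiv_eq_sum {F : Type*} [NormedAddCommGroup F] [NormedSpace ℝ F]
    (hc : c ∈ atlas (EuclideanSpace ℝ (Fin n)) M) {y : EuclideanSpace ℝ (Fin n)}
    (hy : y ∈ c.target) {f : M → F} (hf : MDifferentiableAt (𝓡 n) 𝓘(ℝ, F) f (c.symm y))
    (v : TangentSpace (𝓡 n) (c.symm y)) :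
    mvfderiv (𝓡 n) f (c.symm y) v = ∑ i, mvfderiv (𝓡 n) c (c.symm y) v i •
      fderiv ℝ (fun z => f (c.symm z)) y (e i) := by
  conv_lhs => rw [eq_sum_coordVec hc hy v]
  rw [map_sum]
  simp only [map_smul, mvfderiv_coordVec hc hy hf]

/-- The matrix `g_{ij} = g(∂ᵢ, ∂ⱼ)` of the metric in a chart. -/
def gram (g : Metric n M) (c : OpenPartialHomeomorph M (EuclideanSpace ℝ (Fin n)))
    (y : EuclideanSpace ℝ (Fin n)) : Matrix (Fin n) (Fin n) ℝ :=
  Matrix.of fun i j : Fin n => g.inner (c.symm y) (coordVec c i y) (coordVec c j y)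

/-- The covariant components `X_i = g(X, ∂ᵢ)` of a vector field in a chart. -/
def lowerComp (g : Metric n M) (c : OpenPartialHomeomorph M (EuclideanSpace ℝ (Fin n)))
    (X : (x : M) → TangentSpace (𝓡 n) x) (i : Fin n) (y : EuclideanSpace ℝ (Fin n)) : ℝ :=
  g.inner (c.symm y) (X (c.symm y)) (coordVec c i y)

theorem volDensity_eq (g : Metric n M)
    (c : OpenPartialHomeomorph M (EuclideanSpace ℝ (Fin n))) (y : EuclideanSpace ℝ (Fin n)) :
    volDensity g c y = √(gram g c y).det := rfl

theorem inner_eq_sum_gram (g : Metric n M) (hc : c ∈ atlas (EuclideanSpace ℝ (Fin n)) M) {x : M}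
    (hx : x ∈ c.source) (v w : TangentSpace (𝓡 n) x) :
    g.inner x v w = ∑ i, ∑ j, mvfderiv (𝓡 n) c x v i * gram g c (c x) i j *
      mvfderiv (𝓡 n) c x w j := by
  obtain ⟨y, hy, rfl⟩ : ∃ y ∈ c.target, c.symm y = x := ⟨c x, c.map_source hx, c.left_inv hx⟩
  rw [c.right_inv hy]
  conv_lhs => rw [eq_sum_coordVec hc hy v, eq_sum_coordVec hc hy w]
  simp only [map_sum, map_smul, sum_apply, smul_apply,
    smul_eq_mul, gram, Matrix.of_apply, Finset.mul_sum]
  rw [Finset.sum_comm]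
  refine Finset.sum_congr rfl fun i _ => Finset.sum_congr rfl fun j _ => by ring

theorem gram_isHermitian (g : Metric n M)
    (c : OpenPartialHomeomorph M (EuclideanSpace ℝ (Fin n))) (y : EuclideanSpace ℝ (Fin n)) :
    (gram g c y).IsHermitian := by
  ext i j
  simp [gram, g.symm (c.symm y) (coordVec c i y)]

theorem gram_posDef (g : Metric n M) (hc : c ∈ atlas (EuclideanSpace ℝ (Fin n)) M)
    {y : EuclideanSpace ℝ (Fin n)} (hy : y ∈ c.target) : (gram g c y).PosDef := by
  refine Matrix.PosDef.of_dotProduct_mulVec_pos (gram_isHermitian g c y) fun x hx => ?_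
  let v : TangentSpace (𝓡 n) (c.symm y) := ∑ i, x i • coordVec c i y
  have hv : mvfderiv (𝓡 n) c (c.symm y) v = WithLp.toLp 2 x := by
    rw [map_sum]
    simp only [map_smul, mvfderiv_chart_coordVec hc hy]
    ext j
    simp [Finset.sum_apply, Pi.single_apply]
  have hv0 : v ≠ 0 := by
    intro h
    rw [h, map_zero] at hv
    apply hx
    ext j
    simpa using (congrArg (fun z : EuclideanSpace ℝ (Fin n) => z j) hv).symm
  have h := g.pos _ v hv0
  rw [inner_eq_sum_gram g hc (c.map_target hy), hv, c.right_inv hy] at h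
  simpa [dotProduct, Matrix.mulVec, Finset.mul_sum, mul_assoc] using h

theorem gram_det_pos (g : Metric n M) (hc : c ∈ atlas (EuclideanSpace ℝ (Fin n)) M)
    {y : EuclideanSpace ℝ (Fin n)} (hy : y ∈ c.target) : 0 < (gram g c y).det :=
  (gram_posDef g hc hy).det_pos

theorem volDensity_pos (g : Metric n M) (hc : c ∈ atlas (EuclideanSpace ℝ (Fin n)) M)
    {y : EuclideanSpace ℝ (Fin n)} (hy : y ∈ c.target) : 0 < volDensity g c y :=
  Real.sqrt_pos.2 (gram_det_pos g hc hy)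

/-- The field is the tangent map of `c.symm` applied to a constant section of the tangent bundle of
ℝⁿ. This is the source of the smoothness of the Gram matrix and of the volume density. -/
theorem contMDiffOn_coordVec (hc : c ∈ atlas (EuclideanSpace ℝ (Fin n)) M) (i : Fin n) :
    ContMDiffOn 𝓘(ℝ, EuclideanSpace ℝ (Fin n)) ((𝓡 n).prod 𝓘(ℝ, EuclideanSpace ℝ (Fin n))) ∞
      (fun y => TotalSpace.mk' (EuclideanSpace ℝ (Fin n)) (E := fun x : M => TangentSpace (𝓡 n) x)
        (c.symm y) (coordVec c i y)) c.target := by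
  have := isManifold_one n M
  have h1 : ContMDiffOn (𝓡 n) (𝓡 n) ∞ c.symm c.target :=
    contMDiffOn_symm_of_mem_maximalAtlas (IsManifold.subset_maximalAtlas hc)
  have h2 := h1.contMDiffOn_tangentMapWithin (m := ∞) (by norm_num)
    c.open_target.uniqueMDiffOn
  have h3 : ContMDiff 𝓘(ℝ, EuclideanSpace ℝ (Fin n))
      ((𝓡 n).prod 𝓘(ℝ, EuclideanSpace ℝ (Fin n))) ∞
      (fun y : EuclideanSpace ℝ (Fin n) => (⟨y, (NormedSpace.fromTangentSpace y).symm (e i)⟩ :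
        TangentBundle (𝓡 n) (EuclideanSpace ℝ (Fin n)))) :=
    contMDiff_vectorSpace_iff_contDiff.2 contDiff_const
  refine (h2.comp h3.contMDiffOn (s := c.target) fun y hy => hy).congr fun y hy => ?_
  simp only [Function.comp, tangentMapWithin]
  rw [mfderivWithin_of_isOpen c.open_target hy]
  rfl

theorem contMDiffOn_inner_along (g : Metric n M) {s : Set (EuclideanSpace ℝ (Fin n))}
    {b : EuclideanSpace ℝ (Fin n) → M} {v w : ∀ y, TangentSpace (𝓡 n) (b y)}
    (hv : ContMDiffOn 𝓘(ℝ, EuclideanSpace ℝ (Fin n))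
      ((𝓡 n).prod 𝓘(ℝ, EuclideanSpace ℝ (Fin n))) ∞
      (fun y => TotalSpace.mk' (EuclideanSpace ℝ (Fin n)) (E := fun x : M => TangentSpace (𝓡 n) x)
        (b y) (v y)) s)
    (hw : ContMDiffOn 𝓘(ℝ, EuclideanSpace ℝ (Fin n))
      ((𝓡 n).prod 𝓘(ℝ, EuclideanSpace ℝ (Fin n))) ∞
      (fun y => TotalSpace.mk' (EuclideanSpace ℝ (Fin n)) (E := fun x : M => TangentSpace (𝓡 n) x)
        (b y) (w y)) s) :
    ContDiffOn ℝ ∞ (fun y => g.inner (b y) (v y) (w y)) s := by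
  let _ : RiemannianBundle (fun x : M => TangentSpace (𝓡 n) x) := ⟨g.toRiemannianMetric⟩
  exact (ContMDiffOn.inner_bundle (IB := 𝓡 n) hv hw).contDiffOn

theorem contDiffOn_gram (g : Metric n M) (hc : c ∈ atlas (EuclideanSpace ℝ (Fin n)) M)
    (i j : Fin n) : ContDiffOn ℝ ∞ (fun y => gram g c y i j) c.target :=
  contMDiffOn_inner_along g (contMDiffOn_coordVec hc i) (contMDiffOn_coordVec hc j)

theorem contDiffOn_det {F : Type*} [NormedAddCommGroup F] [NormedSpace ℝ F] {s : Set F}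
    {A : F → Matrix (Fin n) (Fin n) ℝ} (hA : ∀ i j, ContDiffOn ℝ ∞ (fun y => A y i j) s) :
    ContDiffOn ℝ ∞ (fun y => (A y).det) s := by
  simp only [Matrix.det_apply]
  exact ContDiffOn.sum fun σ _ => (contDiffOn_prod fun i _ => hA _ _).const_smul _

theorem contDiffOn_gram_det (g : Metric n M) (hc : c ∈ atlas (EuclideanSpace ℝ (Fin n)) M) :
    ContDiffOn ℝ ∞ (fun y => (gram g c y).det) c.target :=
  contDiffOn_det (contDiffOn_gram g hc)

theorem contDiffOn_volDensity (g : Metric n M) (hc : c ∈ atlas (EuclideanSpace ℝ (Fin n)) M) :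
    ContDiffOn ℝ ∞ (volDensity g c) c.target :=
  (contDiffOn_gram_det g hc).sqrt fun _ hy => (gram_det_pos g hc hy).ne'

/-- Cramer's rule: an entry of the inverse is a determinant, with one row of the Gram matrix
replaced by a constant one, divided by the nonvanishing determinant. -/
theorem contDiffOn_gram_inv (g : Metric n M) (hc : c ∈ atlas (EuclideanSpace ℝ (Fin n)) M)
    (i j : Fin n) : ContDiffOn ℝ ∞ (fun y => (gram g c y)⁻¹ i j) c.target := by
  simp only [Matrix.inv_def, Ring.inverse_eq_inv', Matrix.smul_apply, Matrix.adjugate_apply,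
    smul_eq_mul]
  refine ((contDiffOn_gram_det g hc).inv fun y hy => (gram_det_pos g hc hy).ne').mul
    (contDiffOn_det fun k l => ?_)
  by_cases h : k = j
  · subst h
    simpa using contDiffOn_const
  · simpa [Matrix.updateRow_ne h] using contDiffOn_gram g hc k l

/-- Raising the index: `Xⁱ = ∑ⱼ g^{ij} X_j`. -/
theorem coordComp_eq_sum (g : Metric n M) (hc : c ∈ atlas (EuclideanSpace ℝ (Fin n)) M)
    {y : EuclideanSpace ℝ (Fin n)} (hy : y ∈ c.target) (X : (x : M) → TangentSpace (𝓡 n) x)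
    (i : Fin n) :
    coordComp c X i y = ∑ j, (gram g c y)⁻¹ i j * lowerComp g c X j y := by
  have h : (fun j => lowerComp g c X j y) =
      (gram g c y).mulVec (fun i => coordComp c X i y) := by
    ext j
    rw [lowerComp, inner_eq_sum_gram g hc (c.map_target hy), mvfderiv_chart_coordVec hc hy,
      c.right_inv hy]
    simp only [Matrix.mulVec, dotProduct]
    refine Finset.sum_congr rfl fun k _ => ?_
    have := (gram_isHermitian g c y).apply k j
    simp only [star_trivial] at this
    simp [coordComp, ← this, mul_comm]
  have h2 : ∑ j, (gram g c y)⁻¹ i j * lowerComp g c X j y =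
      (gram g c y)⁻¹.mulVec (fun j => lowerComp g c X j y) i := rfl
  rw [h2, h, Matrix.mulVec_mulVec, Matrix.nonsing_inv_mul _ (gram_det_pos g hc hy).ne'.isUnit,
    Matrix.one_mulVec]

/-- The differential of `f` along `X` is `∑ᵢ Xⁱ ∂ᵢf`. -/
theorem mvfderiv_eq_sum_coordComp (hc : c ∈ atlas (EuclideanSpace ℝ (Fin n)) M)
    {y : EuclideanSpace ℝ (Fin n)} (hy : y ∈ c.target) {f : M → ℝ}
    (hf : MDifferentiableAt (𝓡 n) 𝓘(ℝ, ℝ) f (c.symm y)) (X : (x : M) → TangentSpace (𝓡 n) x) :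
    mvfderiv (𝓡 n) f (c.symm y) (X (c.symm y)) =
      ∑ i, coordComp c X i y * fderiv ℝ (fun z => f (c.symm z)) y (e i) :=
  mvfderiv_eq_sum hc hy hf _

/-- `g(X, Y) = ∑ᵢ Xⁱ Y_i`. -/
theorem inner_eq_sum_coordComp (g : Metric n M) (hc : c ∈ atlas (EuclideanSpace ℝ (Fin n)) M)
    {y : EuclideanSpace ℝ (Fin n)} (hy : y ∈ c.target) (X Y : (x : M) → TangentSpace (𝓡 n) x) :
    g.inner (c.symm y) (X (c.symm y)) (Y (c.symm y)) =
      ∑ i, coordComp c X i y * lowerComp g c Y i y := by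
  conv_lhs => rw [eq_sum_coordVec hc hy (X (c.symm y))]
  simp only [map_sum, map_smul, sum_apply, smul_apply,
    smul_eq_mul]
  refine Finset.sum_congr rfl fun i _ => ?_
  rw [g.symm]
  rfl

theorem lowerComp_grad (g : Metric n M) (hc : c ∈ atlas (EuclideanSpace ℝ (Fin n)) M)
    {y : EuclideanSpace ℝ (Fin n)} (hy : y ∈ c.target) {f : M → ℝ}
    (hf : MDifferentiableAt (𝓡 n) 𝓘(ℝ, ℝ) f (c.symm y)) (i : Fin n) :
    lowerComp g c (grad g f) i y = fderiv ℝ (fun z => f (c.symm z)) y (e i) := by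
  rw [lowerComp, inner_grad, mvfderiv_coordVec hc hy hf]

theorem contDiffOn_comp_symm (hc : c ∈ atlas (EuclideanSpace ℝ (Fin n)) M) {f : M → ℝ}
    (hf : ContMDiff (𝓡 n) 𝓘(ℝ, ℝ) ∞ f) : ContDiffOn ℝ ∞ (fun z => f (c.symm z)) c.target :=
  (hf.comp_contMDiffOn
    (contMDiffOn_symm_of_mem_maximalAtlas (IsManifold.subset_maximalAtlas hc))).contDiffOn

theorem contDiffOn_fderiv_apply {s : Set (EuclideanSpace ℝ (Fin n))} (hs : IsOpen s)
    {f : EuclideanSpace ℝ (Fin n) → ℝ} (hf : ContDiffOn ℝ ∞ f s) (v : EuclideanSpace ℝ (Fin n)) :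
    ContDiffOn ℝ ∞ (fun y => fderiv ℝ f y v) s :=
  (hf.fderiv_of_isOpen hs (by norm_num)).clm_apply contDiffOn_const

theorem contDiffOn_coordComp_grad (g : Metric n M)
    (hc : c ∈ atlas (EuclideanSpace ℝ (Fin n)) M) {f : M → ℝ}
    (hf : ContMDiff (𝓡 n) 𝓘(ℝ, ℝ) ∞ f) (i : Fin n) :
    ContDiffOn ℝ ∞ (coordComp c (grad g f) i) c.target := by
  have h : ContDiffOn ℝ ∞ (fun y => ∑ j, (gram g c y)⁻¹ i j *
      fderiv ℝ (fun z => f (c.symm z)) y (e j)) c.target :=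
    ContDiffOn.sum fun j _ => (contDiffOn_gram_inv g hc i j).mul
      (contDiffOn_fderiv_apply c.open_target (contDiffOn_comp_symm hc hf) (e j))
  refine h.congr fun y hy => ?_
  rw [coordComp_eq_sum g hc hy]
  refine Finset.sum_congr rfl fun j _ => ?_
  rw [lowerComp_grad g hc hy (hf.mdifferentiableAt (by simp))]

/-- The Gram matrices of two charts differ by the Jacobian of the coordinate change. -/
theorem gram_eq_transition (g : Metric n M) (hc : c ∈ atlas (EuclideanSpace ℝ (Fin n)) M)
    {c' : OpenPartialHomeomorph M (EuclideanSpace ℝ (Fin n))}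
    (hc' : c' ∈ atlas (EuclideanSpace ℝ (Fin n)) M) {y : EuclideanSpace ℝ (Fin n)}
    (hy : y ∈ c.target) (hy' : c.symm y ∈ c'.source) :
    gram g c y = (Matrix.of fun i j => fderiv ℝ (fun z => c' (c.symm z)) y (e j) i).transpose *
      gram g c' (c' (c.symm y)) *
      (Matrix.of fun i j => fderiv ℝ (fun z => c' (c.symm z)) y (e j) i) := by
  ext i j
  have hd : MDifferentiableAt (𝓡 n) 𝓘(ℝ, EuclideanSpace ℝ (Fin n)) c' (c.symm y) :=
    (mdifferentiable_of_mem_atlas' hc').mdifferentiableAt hy'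
  rw [gram, Matrix.of_apply, inner_eq_sum_gram g hc' hy', mvfderiv_coordVec hc hy hd,
    mvfderiv_coordVec hc hy hd]
  simp only [Matrix.mul_apply, Matrix.transpose_apply, Matrix.of_apply, Finset.sum_mul]
  exact Finset.sum_comm

/-- Take determinants in `gram_eq_transition`: the Jacobian enters squared, and the root leaves its
absolute value, which is the factor in the change of variables formula. -/
theorem volDensity_eq_transition (g : Metric n M)
    (hc : c ∈ atlas (EuclideanSpace ℝ (Fin n)) M)
    {c' : OpenPartialHomeomorph M (EuclideanSpace ℝ (Fin n))}
    (hc' : c' ∈ atlas (EuclideanSpace ℝ (Fin n)) M) {y : EuclideanSpace ℝ (Fin n)}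
    (hy : y ∈ c.target) (hy' : c.symm y ∈ c'.source) :
    volDensity g c y = |(fderiv ℝ (fun z => c' (c.symm z)) y).det| *
      volDensity g c' (c' (c.symm y)) := by
  have hdet : (Matrix.of fun i j => fderiv ℝ (fun z => c' (c.symm z)) y (e j) i).det =
      (fderiv ℝ (fun z => c' (c.symm z)) y).det := by
    rw [ContinuousLinearMap.det,
      ← LinearMap.det_toMatrix (EuclideanSpace.basisFun (Fin n) ℝ).toBasis]
    rfl
  rw [volDensity_eq, volDensity_eq, gram_eq_transition g hc hc' hy hy', Matrix.det_mul,
    Matrix.det_mul, Matrix.det_transpose, hdet, mul_right_comm, Real.sqrt_mul (mul_self_nonneg _),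
    Real.sqrt_mul_self_eq_abs]

end ChartCalculus

/-! ### The Riemannian volume is the coordinate volume in every chart. -/

section VolumeInCharts

set_option linter.unusedSectionVars false

variable {n : ℕ} {M : Type*} [TopologicalSpace M]
  [ChartedSpace (EuclideanSpace ℝ (Fin n)) M] [IsManifold (𝓡 n) ∞ M]
  [T2Space M] [SigmaCompactSpace M] [MeasurableSpace M] [BorelSpace M]
  {c c' : OpenPartialHomeomorph M (EuclideanSpace ℝ (Fin n))}

theorem aemeasurable_chart_symm {μ : Measure (EuclideanSpace ℝ (Fin n))}
    (c : OpenPartialHomeomorph M (EuclideanSpace ℝ (Fin n))) :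
    AEMeasurable c.symm (μ.restrict c.target) :=
  c.continuousOn_symm.aemeasurable c.open_target.measurableSet

theorem aemeasurable_chart_symm_withDensity (g : Metric n M)
    (c : OpenPartialHomeomorph M (EuclideanSpace ℝ (Fin n))) :
    AEMeasurable c.symm ((volume.restrict c.target).withDensity
      (fun y => ENNReal.ofReal (volDensity g c y))) :=
  (aemeasurable_chart_symm c).mono_ac (withDensity_absolutelyContinuous _ _)

theorem _root_.ContinuousOn.measurableSet_inter_preimage {α β : Type*} [TopologicalSpace α]
    [MeasurableSpace α] [BorelSpace α] [TopologicalSpace β] [MeasurableSpace β] [BorelSpace β]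
    {f : α → β} {t : Set α} (hf : ContinuousOn f t) (ht : MeasurableSet t)
    {s : Set β} (hs : MeasurableSet s) : MeasurableSet (t ∩ f ⁻¹' s) := by
  have h : Measurable (t.domRestrict f) :=
    (continuousOn_iff_continuous_domRestrict.1 hf).measurable
  have h2 := (MeasurableEmbedding.subtype_coe ht).measurableSet_image.2 (h hs)
  convert h2 using 1
  ext y
  simp only [mem_inter_iff, mem_preimage, mem_image, Subtype.exists, exists_and_right, exists_eq_right,
    Set.domRestrict_apply]
  exact ⟨fun h => ⟨h.1, h.2⟩, fun ⟨h, h'⟩ => ⟨h, h'⟩⟩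

theorem chartVolume_apply (g : Metric n M)
    (c : OpenPartialHomeomorph M (EuclideanSpace ℝ (Fin n))) {s : Set M} (hs : MeasurableSet s) :
    chartVolume g c s =
      ∫⁻ y in c.target ∩ c.symm ⁻¹' s, ENNReal.ofReal (volDensity g c y) := by
  rw [chartVolume, Measure.map_apply_of_aemeasurable (aemeasurable_chart_symm_withDensity g c) hs,
    withDensity_apply', Measure.restrict_restrict' c.open_target.measurableSet, inter_comm]

theorem chartVolume_compl_source (g : Metric n M)
    (c : OpenPartialHomeomorph M (EuclideanSpace ℝ (Fin n))) :
    chartVolume g c c.sourceᶜ = 0 := by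
  rw [chartVolume_apply g c c.open_source.measurableSet.compl]
  have : c.target ∩ c.symm ⁻¹' c.sourceᶜ = ∅ := by
    ext y
    simp only [mem_inter_iff, mem_preimage, mem_compl_iff, mem_empty_iff_false, iff_false, not_and,
      not_not]
    exact fun hy => c.map_target hy
  rw [this, Measure.restrict_empty, lintegral_zero_measure]

theorem ae_chartVolume_mem_source (g : Metric n M)
    (c : OpenPartialHomeomorph M (EuclideanSpace ℝ (Fin n))) :
    ∀ᵐ x ∂chartVolume g c, x ∈ c.source :=
  chartVolume_compl_source g c

/-- Change of variables: the volume measures of two charts agree on the overlap. -/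
theorem chartVolume_eq_of_subset (g : Metric n M) (hc : c ∈ atlas (EuclideanSpace ℝ (Fin n)) M)
    (hc' : c' ∈ atlas (EuclideanSpace ℝ (Fin n)) M) {s : Set M} (hs : MeasurableSet s)
    (hsc : s ⊆ c.source) (hsc' : s ⊆ c'.source) : chartVolume g c s = chartVolume g c' s := by
  rw [chartVolume_apply g c hs, chartVolume_apply g c' hs]
  set A := c.target ∩ c.symm ⁻¹' s with hA
  have hAm : MeasurableSet A :=
    c.continuousOn_symm.measurableSet_inter_preimage c.open_target.measurableSet hs
  have himage : c'.target ∩ c'.symm ⁻¹' s = (fun y => c' (c.symm y)) '' A := by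
    ext z
    simp only [mem_inter_iff, mem_preimage, mem_image, hA]
    constructor
    · rintro ⟨hz, hzs⟩
      refine ⟨c (c'.symm z), ⟨c.map_source (hsc hzs), ?_⟩, ?_⟩
      · rwa [c.left_inv (hsc hzs)]
      · rw [c.left_inv (hsc hzs), c'.right_inv hz]
    · rintro ⟨y, ⟨hy, hys⟩, rfl⟩
      refine ⟨c'.map_source (hsc' hys), ?_⟩
      rwa [c'.left_inv (hsc' hys)]
  have hdiff : ∀ y ∈ A, HasFDerivWithinAt (fun y => c' (c.symm y))
      (fderiv ℝ (fun y => c' (c.symm y)) y) A y := by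
    intro y hy
    have h1 : MDifferentiableAt 𝓘(ℝ, EuclideanSpace ℝ (Fin n))
        𝓘(ℝ, EuclideanSpace ℝ (Fin n)) (c' ∘ c.symm) y :=
      ((mdifferentiable_of_mem_atlas' hc').mdifferentiableAt (hsc' hy.2)).comp y
        ((mdifferentiable_of_mem_atlas' hc).mdifferentiableAt_symm hy.1)
    exact h1.differentiableAt.hasFDerivAt.hasFDerivWithinAt
  have hinj : InjOn (fun y => c' (c.symm y)) A := by
    intro y hy z hz hyz
    have := c'.injOn (hsc' hy.2) (hsc' hz.2) hyz
    exact c.symm.injOn hy.1 hz.1 this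
  rw [himage, lintegral_image_eq_lintegral_abs_det_fderiv_mul volume hAm hdiff hinj]
  refine setLIntegral_congr_fun hAm fun y hy => ?_
  rw [volDensity_eq_transition g hc hc' hy.1 (hsc' hy.2), ENNReal.ofReal_mul (abs_nonneg _)]

theorem chartVolume_restrict_eq (g : Metric n M) (hc : c ∈ atlas (EuclideanSpace ℝ (Fin n)) M)
    (hc' : c' ∈ atlas (EuclideanSpace ℝ (Fin n)) M) :
    (chartVolume g c).restrict (c.source ∩ c'.source) =
      (chartVolume g c').restrict (c.source ∩ c'.source) := by
  ext s hs
  have hm : MeasurableSet (s ∩ (c.source ∩ c'.source)) :=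
    hs.inter (c.open_source.inter c'.open_source).measurableSet
  rw [Measure.restrict_apply hs, Measure.restrict_apply hs]
  exact chartVolume_eq_of_subset g hc hc' hm (fun x hx => hx.2.1) fun x hx => hx.2.2

/-- The partition is indexed by all points of M. Local finiteness and σ-compactness leave countably
many nonzero members, which permits exchanging sum and integral in
`riemannianVolume_restrict_source`. -/
theorem countable_chartPartition_ne_zero (n : ℕ) (M : Type*) [TopologicalSpace M]
    [ChartedSpace (EuclideanSpace ℝ (Fin n)) M] [IsManifold (𝓡 n) ∞ M]
    [T2Space M] [SigmaCompactSpace M] :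
    {p : M | (Function.support (chartPartition n M p)).Nonempty}.Countable := by
  have h := (chartPartition n M).locallyFinite
  have h2 : LocallyFinite fun p : {p : M | (Function.support (chartPartition n M p)).Nonempty} =>
      Function.support (chartPartition n M p) :=
    h.comp_injective Subtype.val_injective
  rw [← Set.countable_coe_iff, ← Set.countable_univ_iff]
  exact h2.countable_univ fun p => p.2

theorem chartPartition_eq_zero {p x : M}
    (hx : x ∉ (chartAt (EuclideanSpace ℝ (Fin n)) p).source) : chartPartition n M p x = 0 := by
  by_contra h
  exact hx (chartPartition_isSubordinate p (subset_tsupport _ h))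

theorem tsum_chartPartition (x : M) :
    ∑' p : M, ENNReal.ofReal (chartPartition n M p x) = 1 := by
  have h := (chartPartition n M).sum_eq_one (mem_univ x)
  have hf : (Function.support fun p => chartPartition n M p x).Finite :=
    (chartPartition n M).locallyFinite.point_finite x
  rw [finsum_eq_sum _ hf] at h
  rw [tsum_eq_sum (s := hf.toFinset), ← ENNReal.ofReal_sum_of_nonneg, h, ENNReal.ofReal_one]
  · exact fun p _ => (chartPartition n M).nonneg p x
  · intro p hp
    have : chartPartition n M p x = 0 := by simpa using hp
    simp [this]

/-- In the domain of a chart, the Riemannian volume is `(det g)^{1/2} dy`. -/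
theorem riemannianVolume_restrict_source (g : Metric n M)
    (hc : c ∈ atlas (EuclideanSpace ℝ (Fin n)) M) :
    (riemannianVolume g).restrict c.source = chartVolume g c := by
  ext s hs
  have hsm : MeasurableSet (s ∩ c.source) := hs.inter c.open_source.measurableSet
  have hstep : ∀ p : M, (chartVolume g (chartAt (EuclideanSpace ℝ (Fin n)) p)).withDensity
      (fun x => ENNReal.ofReal (chartPartition n M p x)) (s ∩ c.source) =
      ∫⁻ x in s ∩ c.source, ENNReal.ofReal (chartPartition n M p x) ∂chartVolume g c := by
    intro p
    set d := chartAt (EuclideanSpace ℝ (Fin n)) p with hd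
    -- The weight vanishes off the domain of its chart, so only the overlap with `c.source`
    -- contributes, and there the two chart measures coincide.
    have hind : ∀ μ : Measure M,
        ∫⁻ x in s ∩ c.source, ENNReal.ofReal (chartPartition n M p x) ∂μ =
        ∫⁻ x in s, ENNReal.ofReal (chartPartition n M p x)
          ∂(μ.restrict (c.source ∩ d.source)) := by
      intro μ
      rw [Measure.restrict_restrict hs, ← inter_assoc]
      have : ∀ x, ENNReal.ofReal (chartPartition n M p x) =
          d.source.indicator (fun x => ENNReal.ofReal (chartPartition n M p x)) x := by
        intro x
        by_cases hx : x ∈ d.source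
        · rw [indicator_of_mem hx]
        · rw [indicator_of_notMem hx, chartPartition_eq_zero hx, ENNReal.ofReal_zero]
      conv_lhs => enter [2, x]; rw [this x]
      rw [setLIntegral_indicator d.open_source.measurableSet, inter_comm]
    rw [withDensity_apply _ hsm, hind, hind, inter_comm,
      chartVolume_restrict_eq g (chart_mem_atlas _ p) hc]
  rw [Measure.restrict_apply hs, riemannianVolume, Measure.sum_apply _ hsm]
  simp only [hstep]
  have hcount := countable_chartPartition_ne_zero n M
  set S := {p : M | (Function.support (chartPartition n M p)).Nonempty} with hS
  have hzero : ∀ p ∉ S, ∀ x, chartPartition n M p x = 0 := by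
    intro p hp x
    by_contra h
    exact hp ⟨x, h⟩
  have hsub : ∀ f : M → ENNReal, (∀ p ∉ S, f p = 0) → ∑' p, f p = ∑' p : S, f p := by
    intro f hf
    refine (tsum_subtype_eq_of_support_subset fun p hp => ?_).symm
    by_contra h
    exact hp (hf p h)
  have := hcount.to_subtype
  rw [hsub _ (fun p hp => by simp [hzero p hp]), ← lintegral_tsum]
  · have : ∀ x, ∑' p : S, ENNReal.ofReal (chartPartition n M (p : M) x) = 1 := by
      intro x
      rw [← hsub (fun p => ENNReal.ofReal (chartPartition n M p x))
        (fun p hp => by simp [hzero p hp]), tsum_chartPartition]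
    simp only [this, lintegral_one, Measure.restrict_apply_univ]
    refine measure_congr ?_
    filter_upwards [ae_chartVolume_mem_source g c] with x hx
    exact propext ⟨fun h => h.1, fun h => ⟨h, hx⟩⟩
  · intro p
    exact ((chartPartition n M (p : M)).contMDiff.continuous.measurable.ennreal_ofReal).aemeasurable

theorem ae_chartVolume_of_ae (g : Metric n M) {P : M → Prop}
    (h : ∀ᵐ y ∂(volume.restrict c.target), P (c.symm y)) : ∀ᵐ x ∂chartVolume g c, P x := by
  obtain ⟨N, hN, hNm, hN0⟩ := exists_measurable_superset_of_null (ae_iff.1 h)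
  have hm : MeasurableSet (c.source ∩ c ⁻¹' N) :=
    c.continuousOn.measurableSet_inter_preimage c.open_source.measurableSet hNm
  have h0 : chartVolume g c (c.source ∩ c ⁻¹' N) = 0 := by
    rw [chartVolume_apply g c hm]
    refine setLIntegral_measure_zero _ _ (measure_mono_null ?_
      ((Measure.restrict_apply hNm).symm.trans hN0))
    rintro y ⟨hy, hy1, hy2⟩
    rw [mem_preimage, c.right_inv hy] at hy2
    exact ⟨hy2, hy⟩
  filter_upwards [ae_chartVolume_mem_source g c, measure_eq_zero_iff_ae_notMem.1 h0] with x hx hx0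
  by_contra hP
  refine hx0 ⟨hx, hN ?_⟩
  simpa [c.left_inv hx] using hP

theorem volDensity_nonneg (g : Metric n M)
    (c : OpenPartialHomeomorph M (EuclideanSpace ℝ (Fin n))) (y : EuclideanSpace ℝ (Fin n)) :
    0 ≤ volDensity g c y :=
  Real.sqrt_nonneg _

theorem aemeasurable_ofReal_volDensity (g : Metric n M)
    (hc : c ∈ atlas (EuclideanSpace ℝ (Fin n)) M) :
    AEMeasurable (fun y => ENNReal.ofReal (volDensity g c y)) (volume.restrict c.target) :=
  ((contDiffOn_volDensity g hc).continuousOn.aemeasurable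
    c.open_target.measurableSet).ennreal_ofReal

/-- Positivity of the density keeps the chart measure from having more null sets than Lebesgue
measure. Through this the a.e. eikonal equation reaches the coordinates. -/
theorem ae_of_ae_chartVolume (g : Metric n M) (hc : c ∈ atlas (EuclideanSpace ℝ (Fin n)) M)
    {P : M → Prop} (h : ∀ᵐ x ∂chartVolume g c, P x) :
    ∀ᵐ y ∂(volume.restrict c.target), P (c.symm y) := by
  have h1 := ae_of_ae_map (aemeasurable_chart_symm_withDensity g c) h
  rw [ae_withDensity_iff' (aemeasurable_ofReal_volDensity g hc)] at h1
  filter_upwards [h1, ae_restrict_mem c.open_target.measurableSet] with y hy hyt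
  exact hy (by simpa using volDensity_pos g hc hyt)

/-- Almost everywhere statements on an open set, read in a chart. -/
theorem ae_chart_of_ae_restrict (g : Metric n M) (hc : c ∈ atlas (EuclideanSpace ℝ (Fin n)) M)
    {U : Set M} (hU : MeasurableSet U) {P : M → Prop}
    (h : ∀ᵐ x ∂(riemannianVolume g).restrict U, P x) :
    ∀ᵐ y ∂volume, y ∈ c.target ∩ c.symm ⁻¹' U → P (c.symm y) := by
  rw [ae_restrict_iff' hU] at h
  have h1 := ae_restrict_of_ae (s := c.source) h
  rw [riemannianVolume_restrict_source g hc] at h1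
  have h2 := ae_of_ae_chartVolume g hc h1
  rw [ae_restrict_iff' c.open_target.measurableSet] at h2
  filter_upwards [h2] with y hy hyt using hy hyt.1 hyt.2

/-- Measurability of expressions in the weak gradient is known only in coordinates. It returns to M
by composing a measurable representative with the chart, on whose source the measure is
concentrated. -/
theorem aestronglyMeasurable_chartVolume (g : Metric n M) {f : M → ℝ}
    (hf : AEStronglyMeasurable (fun y => f (c.symm y)) (volume.restrict c.target)) :
    AEStronglyMeasurable f (chartVolume g c) := by
  have h1 : ∀ᵐ y ∂(volume.restrict c.target), f (c.symm y) = hf.mk _ (c (c.symm y)) := by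
    filter_upwards [hf.ae_eq_mk, ae_restrict_mem c.open_target.measurableSet] with y hy hyt
    rw [hy, c.right_inv hyt]
  have h2 : f =ᵐ[chartVolume g c] fun x => hf.mk _ (c x) :=
    ae_chartVolume_of_ae g (P := fun x => f x = hf.mk _ (c x)) h1
  have h3 : AEMeasurable c (chartVolume g c) := by
    rw [← Measure.restrict_eq_self_of_ae_mem (ae_chartVolume_mem_source g c)]
    exact c.continuousOn.aemeasurable c.open_source.measurableSet
  exact ((hf.stronglyMeasurable_mk.measurable.comp_aemeasurable h3).aestronglyMeasurable).congr
    h2.symm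

theorem integrable_chartVolume (g : Metric n M) (hc : c ∈ atlas (EuclideanSpace ℝ (Fin n)) M)
    {f : M → ℝ} (hf : IntegrableOn (fun y => volDensity g c y * f (c.symm y)) c.target) :
    Integrable f (chartVolume g c) ∧
      ∫ x, f x ∂chartVolume g c = ∫ y in c.target, volDensity g c y * f (c.symm y) := by
  have hcont := (contDiffOn_volDensity g hc).continuousOn
  have hm : AEStronglyMeasurable (fun y => f (c.symm y)) (volume.restrict c.target) := by
    have h1 : AEStronglyMeasurable (fun y => (volDensity g c y)⁻¹ *
        (volDensity g c y * f (c.symm y))) (volume.restrict c.target) :=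
      ((hcont.inv₀ fun y hy => (volDensity_pos g hc hy).ne').aestronglyMeasurable
        c.open_target.measurableSet).mul hf.aestronglyMeasurable
    refine h1.congr ?_
    filter_upwards [ae_restrict_mem c.open_target.measurableSet] with y hy
    rw [inv_mul_cancel_left₀ (volDensity_pos g hc hy).ne']
  have hM := aestronglyMeasurable_chartVolume g hm
  have hpos : ∀ᵐ y ∂(volume.restrict c.target),
      (ENNReal.ofReal (volDensity g c y)).toReal • f (c.symm y) =
        volDensity g c y * f (c.symm y) := by
    filter_upwards with y
    rw [ENNReal.toReal_ofReal (volDensity_nonneg g c y), smul_eq_mul]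
  have hlt : ∀ᵐ y ∂(volume.restrict c.target), ENNReal.ofReal (volDensity g c y) < ⊤ :=
    Filter.Eventually.of_forall fun _ => ENNReal.ofReal_lt_top
  constructor
  · rw [chartVolume, integrable_map_measure hM (aemeasurable_chart_symm_withDensity g c)]
    rw [integrable_withDensity_iff_integrable_smul₀' (aemeasurable_ofReal_volDensity g hc) hlt]
    exact hf.congr (hpos.mono fun y hy => hy.symm)
  · rw [chartVolume, integral_map (aemeasurable_chart_symm_withDensity g c) hM,
      integral_withDensity_eq_integral_toReal_smul₀ (aemeasurable_ofReal_volDensity g hc) hlt]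
    exact integral_congr_ae hpos

/-- Integration in a chart of a function supported in its domain. -/
theorem integrable_and_integral_eq_chart (g : Metric n M)
    (hc : c ∈ atlas (EuclideanSpace ℝ (Fin n)) M) {f : M → ℝ} (hf0 : ∀ x ∉ c.source, f x = 0)
    (hf : IntegrableOn (fun y => volDensity g c y * f (c.symm y)) c.target) :
    Integrable f (riemannianVolume g) ∧ ∫ x, f x ∂riemannianVolume g =
      ∫ y in c.target, volDensity g c y * f (c.symm y) := by
  obtain ⟨h1, h2⟩ := integrable_chartVolume g hc hf
  rw [← riemannianVolume_restrict_source g hc] at h1 h2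
  constructor
  · exact (integrableOn_iff_integrable_of_support_subset fun x hx => by
      by_contra h
      exact hx (hf0 x h)).1 h1
  · rw [← h2, setIntegral_eq_integral_of_forall_compl_eq_zero hf0]

theorem lintegral_chart_pos (g : Metric n M)
    (hc : c ∈ atlas (EuclideanSpace ℝ (Fin n)) M) {V : Set M} (hV : IsOpen V)
    (hVc : (V ∩ c.source).Nonempty) : chartVolume g c V ≠ 0 := by
  rw [chartVolume_apply g c hV.measurableSet]
  have hopen : IsOpen (c.target ∩ c.symm ⁻¹' V) := c.isOpen_inter_preimage_symm hV
  have hne : (c.target ∩ c.symm ⁻¹' V).Nonempty := by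
    obtain ⟨x, hxV, hxc⟩ := hVc
    exact ⟨c x, c.map_source hxc, by rwa [mem_preimage, c.left_inv hxc]⟩
  intro h0
  rw [lintegral_eq_zero_iff' ((aemeasurable_ofReal_volDensity g hc).mono_measure
    (Measure.restrict_mono inter_subset_left le_rfl))] at h0
  have h1 : ∀ᵐ y ∂(volume.restrict (c.target ∩ c.symm ⁻¹' V)), False := by
    filter_upwards [h0, ae_restrict_mem hopen.measurableSet] with y hy hyt
    have := volDensity_pos g hc hyt.1
    simp only [Pi.zero_apply, ENNReal.ofReal_eq_zero] at hy
    linarith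
  rw [Filter.eventually_false_iff_eq_bot, ae_eq_bot, Measure.restrict_eq_zero] at h1
  exact (hopen.measure_pos volume hne).ne' h1

/-- Full support upgrades a.e. equality of continuous functions to equality, as needed in
`divIn_eqOn`. -/
instance isOpenPosMeasure_riemannianVolume (g : Metric n M) :
    (riemannianVolume g).IsOpenPosMeasure where
  open_pos V hV hne h0 := by
    obtain ⟨x, hx⟩ := hne
    have hc := chart_mem_atlas (EuclideanSpace ℝ (Fin n)) x
    refine lintegral_chart_pos g hc hV ⟨x, hx, mem_chart_source _ x⟩ ?_
    rw [← riemannianVolume_restrict_source g hc]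
    exact le_antisymm ((Measure.restrict_apply_le _ _).trans h0.le) bot_le

/-- Local finiteness makes continuous functions of compact support integrable. -/
instance isLocallyFiniteMeasure_riemannianVolume (g : Metric n M) :
    IsLocallyFiniteMeasure (riemannianVolume g) where
  finiteAtNhds x := by
    set c := chartAt (EuclideanSpace ℝ (Fin n)) x with hcdef
    have hc : c ∈ atlas (EuclideanSpace ℝ (Fin n)) M := chart_mem_atlas _ x
    have hx : x ∈ c.source := mem_chart_source _ x
    obtain ⟨K, hK, hxK, hKt⟩ := exists_compact_subset c.open_target (c.map_source hx)
    have hopen : IsOpen (c.source ∩ c ⁻¹' interior K) := c.isOpen_inter_preimage isOpen_interior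
    refine ⟨c.source ∩ c ⁻¹' interior K, hopen.mem_nhds ⟨hx, hxK⟩, ?_⟩
    have h1 : riemannianVolume g (c.source ∩ c ⁻¹' interior K) =
        chartVolume g c (c.source ∩ c ⁻¹' interior K) := by
      rw [← riemannianVolume_restrict_source g hc, Measure.restrict_apply hopen.measurableSet,
        inter_assoc, inter_comm _ c.source, ← inter_assoc, inter_self]
    rw [h1, chartVolume_apply g c hopen.measurableSet]
    have hint : IntegrableOn (volDensity g c) K :=
      ((contDiffOn_volDensity g hc).continuousOn.mono hKt).integrableOn_compact hK
    refine lt_of_le_of_lt (lintegral_mono_set (t := K) ?_) (hint.lintegral_lt_top)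
    rintro y ⟨hy, hy1, hy2⟩
    rw [mem_preimage, c.right_inv hy] at hy2
    exact interior_subset hy2

end VolumeInCharts

/-! ### Mollifying a continuous function with a locally bounded weak gradient. -/

section WeakGradient

open Filter Topology
open scoped Convolution

variable {n : ℕ}

/-- `X` is a locally bounded weak gradient of the continuous function `r` on `Ω ⊆ ℝⁿ`. -/
structure IsBoundedWeakGradientOn (Ω : Set (EuclideanSpace ℝ (Fin n)))
    (r : EuclideanSpace ℝ (Fin n) → ℝ) (X : Fin n → EuclideanSpace ℝ (Fin n) → ℝ) : Prop where
  continuousOn : ContinuousOn r Ω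
  locallyIntegrableOn : ∀ i, LocallyIntegrableOn (X i) Ω
  bounded : ∀ K ⊆ Ω, IsCompact K → ∃ B, ∀ᵐ y, y ∈ K → ∀ i, |X i y| ≤ B
  weak_deriv : ∀ (i : Fin n) (ψ : EuclideanSpace ℝ (Fin n) → ℝ), ContDiff ℝ ∞ ψ →
    HasCompactSupport ψ → tsupport ψ ⊆ Ω → ∫ y, r y * fderiv ℝ ψ y (e i) = - ∫ y, X i y * ψ y

/-- The partial derivatives of a mollification are the mollifications of the weak ones. -/
theorem IsBoundedWeakGradientOn.fderiv_convolution {Ω : Set (EuclideanSpace ℝ (Fin n))}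
    {r : EuclideanSpace ℝ (Fin n) → ℝ} {X : Fin n → EuclideanSpace ℝ (Fin n) → ℝ}
    (h : IsBoundedWeakGradientOn Ω r X) {L : Set (EuclideanSpace ℝ (Fin n))} (hL : IsCompact L)
    (hLΩ : L ⊆ Ω) (φ : ContDiffBump (0 : EuclideanSpace ℝ (Fin n)))
    {y : EuclideanSpace ℝ (Fin n)} (hy : Metric.closedBall y φ.rOut ⊆ L) (i : Fin n) :
    fderiv ℝ (φ.normed volume ⋆[ContinuousLinearMap.lsmul ℝ ℝ, volume] L.indicator r) y (e i) =
      (φ.normed volume ⋆[ContinuousLinearMap.lsmul ℝ ℝ, volume] L.indicator (X i)) y := by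
  have hrint : Integrable (L.indicator r) volume :=
    ((h.continuousOn.mono hLΩ).integrableOn_compact hL).integrable_indicator hL.measurableSet
  have hφ : ContDiff ℝ ∞ (φ.normed volume) := φ.contDiff_normed
  have hφc : HasCompactSupport (φ.normed volume) := φ.hasCompactSupport_normed
  rw [(hφc.hasFDerivAt_convolution_left _ (hφ.of_le (by norm_num))
    hrint.locallyIntegrable y).fderiv, convolution_eq_swap, convolution_eq_swap]
  have hex := ((hφc.fderiv (𝕜 := ℝ)).convolutionExists_left
    ((ContinuousLinearMap.lsmul ℝ ℝ).precompL (EuclideanSpace ℝ (Fin n)))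
    (hφ.continuous_fderiv (by norm_num)) hrint.locallyIntegrable y).integrable_swap
  rw [ContinuousLinearMap.integral_apply hex]
  -- The kernel reflected about `y` lives in the ball of radius `φ.rOut`, inside `L`. It is
  -- therefore admissible in the weak derivative, and the cutoff by `L` is invisible to it.
  set ψ : EuclideanSpace ℝ (Fin n) → ℝ := fun t => φ.normed volume (y - t) with hψ
  have hψs : ContDiff ℝ ∞ ψ := hφ.comp (contDiff_const.sub contDiff_id)
  have hsupp : tsupport ψ ⊆ Metric.closedBall y φ.rOut := by
    refine closure_minimal (fun t ht => ?_) Metric.isClosed_closedBall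
    have : y - t ∈ Function.support (φ.normed volume) := ht
    rw [φ.support_normed_eq, mem_ball_zero_iff] at this
    rw [mem_closedBall_iff_norm']
    exact this.le
  have hψc : HasCompactSupport ψ :=
    (isCompact_closedBall y φ.rOut).of_isClosed_subset (isClosed_tsupport _) hsupp
  have hfd : ∀ t, fderiv ℝ ψ t (e i) = - fderiv ℝ (φ.normed volume) (y - t) (e i) := by
    intro t
    have h1 : HasFDerivAt (fun t : EuclideanSpace ℝ (Fin n) => y - t)
        (-ContinuousLinearMap.id ℝ _) t := (hasFDerivAt_id t).const_sub y
    have h2 : HasFDerivAt (φ.normed volume) (fderiv ℝ (φ.normed volume) (y - t)) (y - t) :=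
      (hφ.differentiable (by norm_num) _).hasFDerivAt
    have h3 : HasFDerivAt ψ _ t := h2.comp t h1
    rw [h3.fderiv]
    simp
  have hw := h.weak_deriv i ψ hψs hψc ((hsupp.trans hy).trans hLΩ)
  have hout : ∀ t ∉ L, ψ t = 0 := fun t ht =>
    image_eq_zero_of_notMem_tsupport fun h' => ht (hy (hsupp h'))
  have hout' : ∀ t ∉ L, fderiv ℝ ψ t (e i) = 0 := fun t ht => by
    rw [image_eq_zero_of_notMem_tsupport fun h' => ht (hy (hsupp (tsupport_fderiv_subset ℝ h'))),
      zero_apply]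
  have e1 : ∀ t, ((ContinuousLinearMap.lsmul ℝ ℝ).precompL (EuclideanSpace ℝ (Fin n))
      (fderiv ℝ (φ.normed volume) (y - t)) (L.indicator r t)) (e i) =
      - (r t * fderiv ℝ ψ t (e i)) := by
    intro t
    rw [ContinuousLinearMap.precompL_apply, ContinuousLinearMap.lsmul_apply, smul_eq_mul]
    by_cases ht : t ∈ L
    · rw [indicator_of_mem ht, hfd]; ring
    · rw [indicator_of_notMem ht, hout' t ht]; ring
  have e2 : ∀ t, ContinuousLinearMap.lsmul ℝ ℝ (φ.normed volume (y - t)) (L.indicator (X i) t) =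
      X i t * ψ t := by
    intro t
    rw [ContinuousLinearMap.lsmul_apply, smul_eq_mul]
    by_cases ht : t ∈ L
    · rw [indicator_of_mem ht, mul_comm]
    · rw [indicator_of_notMem ht, hout t ht]; ring
  simp only [e1, e2, integral_neg, hw, neg_neg]

/-- A continuous function with a locally bounded weak gradient is approximated by smooth functions,
uniformly on a compact set, with derivatives that converge boundedly almost everywhere. -/
theorem IsBoundedWeakGradientOn.exists_approx {Ω : Set (EuclideanSpace ℝ (Fin n))}
    (hΩ : IsOpen Ω) {r : EuclideanSpace ℝ (Fin n) → ℝ}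
    {X : Fin n → EuclideanSpace ℝ (Fin n) → ℝ} (h : IsBoundedWeakGradientOn Ω r X)
    {K : Set (EuclideanSpace ℝ (Fin n))} (hK : IsCompact K) (hKΩ : K ⊆ Ω) :
    ∃ f : ℕ → EuclideanSpace ℝ (Fin n) → ℝ, (∀ k, ContDiff ℝ ∞ (f k)) ∧
      TendstoUniformlyOn f r atTop K ∧
      (∀ᵐ y, y ∈ K → ∀ i, Tendsto (fun k => fderiv ℝ (f k) y (e i)) atTop (𝓝 (X i y))) ∧
      ∃ B, ∀ᶠ k in atTop, ∀ y ∈ K, ∀ i, |fderiv ℝ (f k) y (e i)| ≤ B := by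
  -- The closed δ-neighbourhood of `K` leaves room for mollifiers of radius at most δ at every point
  -- of `K`.
  obtain ⟨δ, hδ, hδΩ⟩ := hK.exists_cthickening_subset_open hΩ hKΩ
  set L := Metric.cthickening δ K with hLdef
  have hL : IsCompact L := hK.cthickening
  have hball : ∀ y ∈ K, ∀ s ≤ δ, Metric.closedBall y s ⊆ L := fun y hy s hs =>
    (Metric.closedBall_subset_closedBall hs).trans (Metric.closedBall_subset_cthickening hy δ)
  have hrint : Integrable (L.indicator r) volume :=
    ((h.continuousOn.mono hδΩ).integrableOn_compact hL).integrable_indicator hL.measurableSet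
  have hXint : ∀ i, Integrable (L.indicator (X i)) volume := fun i =>
    ((h.locallyIntegrableOn i).integrableOn_compact_subset hδΩ hL).integrable_indicator
      hL.measurableSet
  let φ : ℕ → ContDiffBump (0 : EuclideanSpace ℝ (Fin n)) := fun k =>
    -- The ratio of outer to inner radius stays 2; a bounded ratio is what the a.e. convergence of
    -- mollifications of an integrable function requires.
    { rIn := δ / (k + 2) / 2
      rOut := δ / (k + 2)
      rIn_pos := by positivity
      rIn_lt_rOut := half_lt_self (by positivity) }
  have hφ0 : Tendsto (fun k => (φ k).rOut) atTop (𝓝 0) := by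
    have : Tendsto (fun k : ℕ => (k : ℝ) + 2) atTop atTop :=
      tendsto_atTop_add_const_right _ _ tendsto_natCast_atTop_atTop
    exact this.const_div_atTop δ
  have hφδ : ∀ k, (φ k).rOut ≤ δ := fun k =>
    div_le_self hδ.le (by have : (0 : ℝ) ≤ k := k.cast_nonneg
                          linarith)
  refine ⟨fun k => (φ k).normed volume ⋆[ContinuousLinearMap.lsmul ℝ ℝ, volume] L.indicator r,
    fun k => ?_, ?_, ?_, ?_⟩
  · exact (φ k).hasCompactSupport_normed.contDiff_convolution_left (n := ⊤) _
      (φ k).contDiff_normed hrint.locallyIntegrable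
  · rw [Metric.tendstoUniformlyOn_iff]
    intro ε hε
    have huc := hL.uniformContinuousOn_of_continuous (h.continuousOn.mono hδΩ)
    rw [Metric.uniformContinuousOn_iff] at huc
    obtain ⟨η, hη, hη'⟩ := huc (ε / 2) (half_pos hε)
    filter_upwards [hφ0.eventually_lt_const hη] with k hk y hy
    rw [dist_comm]
    have hyL : y ∈ L := hball y hy 0 hδ.le (by simp)
    have := ContDiffBump.dist_normed_convolution_le (φ := φ k) (μ := volume) (x₀ := y)
      (ε := ε / 2) hrint.aestronglyMeasurable fun z hz => by
        have hzL : z ∈ L := hball y hy _ (hφδ k) (Metric.ball_subset_closedBall hz)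
        rw [indicator_of_mem hzL, indicator_of_mem hyL]
        exact (hη' z hzL y hyL ((Metric.mem_ball.1 hz).trans hk)).le
    rw [indicator_of_mem hyL] at this
    linarith
  · have h1 : ∀ i, ∀ᵐ y, Tendsto (fun k => ((φ k).normed volume
        ⋆[ContinuousLinearMap.lsmul ℝ ℝ, volume] L.indicator (X i)) y) atTop
        (𝓝 (L.indicator (X i) y)) := fun i =>
      ContDiffBump.ae_convolution_tendsto_right_of_locallyIntegrable (K := 2) hφ0
        (Eventually.of_forall fun k => by
          change δ / (k + 2) ≤ 2 * (δ / (k + 2) / 2)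
          linarith) (hXint i).locallyIntegrable
    filter_upwards [ae_all_iff.2 h1] with y hy hyK i
    have := hy i
    rw [indicator_of_mem (hball y hyK 0 hδ.le (by simp))] at this
    refine this.congr fun k => ?_
    rw [h.fderiv_convolution hL hδΩ (φ k) (hball y hyK _ (hφδ k))]
  · obtain ⟨B, hB⟩ := h.bounded L hδΩ hL
    -- A mollification is an average against a probability density, so it inherits the essential
    -- bound on `L`. The maximum with 0 covers the points where the cutoff vanishes.
    refine ⟨max B 0, Eventually.of_forall fun k y hy i => ?_⟩
    rw [h.fderiv_convolution hL hδΩ (φ k) (hball y hy _ (hφδ k)), convolution_eq_swap]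
    have hint : Integrable (fun t => (φ k).normed volume (y - t) * max B 0) :=
      ((φ k).integrable_normed.comp_sub_left y).mul_const _
    have h1 := norm_integral_le_of_norm_le (f := fun t => ContinuousLinearMap.lsmul ℝ ℝ
      ((φ k).normed volume (y - t)) (L.indicator (X i) t)) hint (by
        filter_upwards [hB] with t ht
        rw [ContinuousLinearMap.lsmul_apply, smul_eq_mul, norm_mul,
          Real.norm_of_nonneg ((φ k).nonneg_normed _)]
        refine mul_le_mul_of_nonneg_left ?_ ((φ k).nonneg_normed _)
        by_cases htL : t ∈ L
        · rw [indicator_of_mem htL]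
          exact (ht htL i).trans (le_max_left _ _)
        · rw [indicator_of_notMem htL, norm_zero]
          exact le_max_right _ _)
    rwa [integral_mul_const, integral_sub_left_eq_self (fun t => (φ k).normed volume t),
      (φ k).integral_normed, one_mul] at h1

end WeakGradient

/-! ### Powers of a weakly differentiable function as factors of test functions. -/

section WeakGradientPower

open Filter Topology

variable {n : ℕ}

theorem integral_fderiv_eq_zero {h : EuclideanSpace ℝ (Fin n) → ℝ} (hh : ContDiff ℝ ∞ h)
    (hc : HasCompactSupport h) (v : EuclideanSpace ℝ (Fin n)) :
    ∫ y, fderiv ℝ h y v = 0 := by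
  have hd : Differentiable ℝ h := hh.differentiable (by norm_num)
  have hcont : Continuous fun y => fderiv ℝ h y v :=
    (hh.continuous_fderiv (by norm_num)).clm_apply continuous_const
  have hint : Integrable (fun y => fderiv ℝ h y v) volume :=
    hcont.integrable_of_hasCompactSupport (hc.fderiv_apply (𝕜 := ℝ) v)
  have := integral_mul_fderiv_eq_neg_fderiv_mul_of_integrable (𝕜 := ℝ) (μ := volume)
    (f := fun _ : EuclideanSpace ℝ (Fin n) => (1 : ℝ)) (g := h) (v := v)
    (by simp) (by simpa using hint)
    (by simpa using hh.continuous.integrable_of_hasCompactSupport hc)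
    (fun x _ => differentiableAt_const _) (fun x _ => hd x)
  simpa using this

/-- Smooth approximations of `r ^ s * ξ` for a test function `ξ`, where `r` is positive and has a
locally bounded weak gradient. -/
theorem IsBoundedWeakGradientOn.exists_rpow_mul_approx {Ω : Set (EuclideanSpace ℝ (Fin n))}
    (hΩ : IsOpen Ω) {r : EuclideanSpace ℝ (Fin n) → ℝ}
    {X : Fin n → EuclideanSpace ℝ (Fin n) → ℝ} (h : IsBoundedWeakGradientOn Ω r X)
    (hpos : ∀ y ∈ Ω, 0 < r y) (s : ℝ) {ξ : EuclideanSpace ℝ (Fin n) → ℝ}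
    (hξ : ContDiff ℝ ∞ ξ) (hξc : HasCompactSupport ξ) (hξΩ : tsupport ξ ⊆ Ω) :
    ∃ ψ : ℕ → EuclideanSpace ℝ (Fin n) → ℝ, (∀ k, ContDiff ℝ ∞ (ψ k)) ∧
      (∀ k, tsupport (ψ k) ⊆ tsupport ξ) ∧
      ((∀ y, 0 ≤ ξ y) → ∀ k y, 0 ≤ ψ k y) ∧
      (∀ y, Tendsto (fun k => ψ k y) atTop (𝓝 (r y ^ s * ξ y))) ∧
      (∀ᵐ y, ∀ i, Tendsto (fun k => fderiv ℝ (ψ k) y (e i)) atTop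
        (𝓝 (s * r y ^ (s - 1) * X i y * ξ y + r y ^ s * fderiv ℝ ξ y (e i)))) ∧
      ∃ B, ∀ k y, |ψ k y| ≤ B ∧ ∀ i, |fderiv ℝ (ψ k) y (e i)| ≤ B := by
  set K := tsupport ξ with hKdef
  have hK : IsCompact K := hξc
  have hrK : ContinuousOn r K := h.continuousOn.mono hξΩ
  obtain ⟨m, hm0, hm⟩ : ∃ m > 0, ∀ y ∈ K, m ≤ r y := by
    rcases K.eq_empty_or_nonempty with hKe | hKn
    · exact ⟨1, one_pos, fun y hy => by simp [hKe] at hy⟩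
    · obtain ⟨x, hx, hxm⟩ := hK.exists_isMinOn hKn hrK
      exact ⟨r x, hpos x (hξΩ hx), fun y hy => hxm hy⟩
  obtain ⟨R, hR⟩ := hK.exists_bound_of_continuousOn hrK
  obtain ⟨f, hf, hfu, hfd, B, hB⟩ := h.exists_approx hΩ hK hξΩ
  rw [Metric.tendstoUniformlyOn_iff] at hfu
  -- Since `r ≥ m` on `K`, an error below `m / 2` keeps the approximants in `[m / 2, R + m]`, where
  -- all real powers are smooth and bounded.
  obtain ⟨N, hN⟩ := eventually_atTop.1 ((hfu (m / 2) (half_pos hm0)).and hB)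
  have hIcc : ∀ k ≥ N, ∀ y ∈ K, f k y ∈ Icc (m / 2) (R + m) := by
    intro k hk y hy
    have h1 := (hN k hk).1 y hy
    rw [Real.dist_eq, abs_lt] at h1
    have h2 := hm y hy
    have h3 := (le_abs_self _).trans (hR y hy)
    constructor <;> linarith [h1.1, h1.2]
  have hfpos : ∀ k ≥ N, ∀ y ∈ K, 0 < f k y := fun k hk y hy =>
    (half_pos hm0).trans_le (hIcc k hk y hy).1
  have hpow : ∀ q : ℝ, ∃ P, ∀ t ∈ Icc (m / 2) (R + m), |t ^ q| ≤ P := fun q =>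
    isCompact_Icc.exists_bound_of_continuousOn (f := fun t : ℝ => t ^ q) fun t ht =>
      (Real.continuousAt_rpow_const _ _
        (Or.inl ((half_pos hm0).trans_le ht.1).ne')).continuousWithinAt
  obtain ⟨P, hP⟩ := hpow s
  obtain ⟨P', hP'⟩ := hpow (s - 1)
  obtain ⟨Z, hZ⟩ := hξc.exists_bound_of_continuous hξ.continuous
  have hdξ : Continuous (fderiv ℝ ξ) := hξ.continuous_fderiv (by norm_num)
  obtain ⟨Z', hZ'⟩ := (hξc.fderiv (𝕜 := ℝ)).exists_bound_of_continuous hdξ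
  have hZi : ∀ y i, |fderiv ℝ ξ y (e i)| ≤ Z' := fun y i => by
    refine ((fderiv ℝ ξ y).le_opNorm (e i)).trans ?_
    simpa using hZ' y
  have hout : ∀ y ∉ K, ξ y = 0 := fun y hy => image_eq_zero_of_notMem_tsupport hy
  have hout' : ∀ y ∉ K, ∀ i, fderiv ℝ ξ y (e i) = 0 := fun y hy i => by
    rw [image_eq_zero_of_notMem_tsupport fun h' => hy (tsupport_fderiv_subset ℝ h'), zero_apply]
  -- The shift by `N` gives every member, not only a tail, positivity on `K`. Off `K` the factor `ξ`
  -- vanishes, so the possibly negative base there is harmless.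
  set ψ : ℕ → EuclideanSpace ℝ (Fin n) → ℝ := fun k y => f (k + N) y ^ s * ξ y with hψ
  have hsub : ∀ k, tsupport (ψ k) ⊆ K := fun k =>
    closure_mono fun y hy => right_ne_zero_of_mul hy
  have hd : ∀ k y i, fderiv ℝ (ψ k) y (e i) =
      s * f (k + N) y ^ (s - 1) * fderiv ℝ (f (k + N)) y (e i) * ξ y +
        f (k + N) y ^ s * fderiv ℝ ξ y (e i) := by
    intro k y i
    by_cases hy : y ∈ K
    · have h1 : HasFDerivAt (f (k + N)) (fderiv ℝ (f (k + N)) y) y :=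
        ((hf (k + N)).differentiable (by norm_num) y).hasFDerivAt
      have h2 : HasFDerivAt ξ (fderiv ℝ ξ y) y :=
        (hξ.differentiable (by norm_num) y).hasFDerivAt
      have h3 : HasFDerivAt (ψ k) _ y := (h1.rpow_const (p := s)
        (Or.inl (hfpos _ (Nat.le_add_left _ _) y hy).ne')).mul h2
      rw [h3.fderiv]
      simp only [add_apply, smul_apply, smul_eq_mul]
      ring
    · rw [hout y hy, hout' y hy, image_eq_zero_of_notMem_tsupport fun h' =>
        hy (hsub k (tsupport_fderiv_subset ℝ h')), zero_apply]
      ring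
  have hconv : ∀ y ∈ K, Tendsto (fun k => f (k + N) y) atTop (𝓝 (r y)) := by
    intro y hy
    refine (tendsto_add_atTop_iff_nat (f := fun k => f k y) N).2 ?_
    rw [Metric.tendsto_nhds]
    intro ε hε
    filter_upwards [hfu ε hε] with k hk
    rw [dist_comm]
    exact hk y hy
  have hconvp : ∀ y ∈ K, ∀ q : ℝ, Tendsto (fun k => f (k + N) y ^ q) atTop (𝓝 (r y ^ q)) :=
    fun y hy q => (hconv y hy).rpow_const (Or.inl (hpos y (hξΩ hy)).ne')
  refine ⟨ψ, fun k => ?_, hsub, fun hξ0 k y => ?_, fun y => ?_, ?_, ?_⟩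
  · refine contDiff_iff_contDiffAt.2 fun y => ?_
    by_cases hy : y ∈ K
    · exact ((hf (k + N)).contDiffAt.rpow_const_of_ne
        (hfpos _ (Nat.le_add_left _ _) y hy).ne').mul hξ.contDiffAt
    · have : ψ k =ᶠ[𝓝 y] fun _ => 0 := by
        filter_upwards [(isClosed_tsupport ξ).isOpen_compl.mem_nhds hy] with z hz
        simp only [hψ, hout z hz, mul_zero]
      exact contDiffAt_const.congr_of_eventuallyEq this
  · by_cases hy : y ∈ K
    · exact mul_nonneg (Real.rpow_nonneg (hfpos _ (Nat.le_add_left _ _) y hy).le _) (hξ0 y)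
    · simp [hψ, hout y hy]
  · by_cases hy : y ∈ K
    · exact (hconvp y hy s).mul_const _
    · simp [hψ, hout y hy]
  · filter_upwards [hfd] with y hy i
    simp only [hd]
    by_cases hyK : y ∈ K
    · exact ((((hconvp y hyK (s - 1)).const_mul s).mul
        ((tendsto_add_atTop_iff_nat (f := fun k => fderiv ℝ (f k) y (e i)) N).2
          (hy hyK i))).mul_const _).add ((hconvp y hyK s).mul_const _)
    · simp [hout y hyK, hout' y hyK]
  · refine ⟨|P| * |Z| + |s| * |P'| * |B| * |Z| + |P| * |Z'|, fun k y => ?_⟩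
    by_cases hy : y ∈ K
    · have hNk : N ≤ k + N := Nat.le_add_left _ _
      have b1 : |f (k + N) y ^ s| ≤ |P| := (hP _ (hIcc _ hNk y hy)).trans (le_abs_self _)
      have b2 : |f (k + N) y ^ (s - 1)| ≤ |P'| := (hP' _ (hIcc _ hNk y hy)).trans (le_abs_self _)
      have b3 : |ξ y| ≤ |Z| := (hZ y).trans (le_abs_self _)
      have b0 : 0 ≤ |s| * |P'| * |B| * |Z| := by positivity
      have b0' : 0 ≤ |P| * |Z'| := by positivity
      have b0'' : 0 ≤ |P| * |Z| := by positivity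
      have c1 : |ψ k y| ≤ |P| * |Z| := by
        simp only [hψ, abs_mul]
        exact mul_le_mul b1 b3 (abs_nonneg _) (abs_nonneg _)
      refine ⟨by linarith, fun i => ?_⟩
      have b4 : |fderiv ℝ (f (k + N)) y (e i)| ≤ |B| :=
        ((hN _ hNk).2 y hy i).trans (le_abs_self _)
      have b5 : |fderiv ℝ ξ y (e i)| ≤ |Z'| := (hZi y i).trans (le_abs_self _)
      rw [hd]
      refine (abs_add_le _ _).trans ?_
      have c2 : |s * f (k + N) y ^ (s - 1) * fderiv ℝ (f (k + N)) y (e i) * ξ y| ≤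
          |s| * |P'| * |B| * |Z| := by
        simp only [abs_mul]
        gcongr
      have c3 : |f (k + N) y ^ s * fderiv ℝ ξ y (e i)| ≤ |P| * |Z'| := by
        simp only [abs_mul]
        gcongr
      linarith
    · have hz : fderiv ℝ (ψ k) y = 0 := image_eq_zero_of_notMem_tsupport fun h' =>
        hy (hsub k (tsupport_fderiv_subset ℝ h'))
      have hz' : ψ k y = 0 := by simp [hψ, hout y hy]
      rw [hz, hz', abs_zero]
      refine ⟨by positivity, fun i => ?_⟩
      rw [zero_apply, abs_zero]
      positivity

/-- Bounded convergence on a compact set. -/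
theorem tendsto_integral_of_bounded_of_isCompact {K : Set (EuclideanSpace ℝ (Fin n))}
    (hK : IsCompact K) {F : ℕ → EuclideanSpace ℝ (Fin n) → ℝ} {G : EuclideanSpace ℝ (Fin n) → ℝ}
    (hm : ∀ k, AEStronglyMeasurable (F k) volume) (h0 : ∀ k, ∀ y ∉ K, F k y = 0) {B : ℝ}
    (hB : ∀ k, ∀ᵐ y, y ∈ K → |F k y| ≤ B)
    (hlim : ∀ᵐ y, Tendsto (fun k => F k y) atTop (𝓝 (G y))) :
    Integrable G ∧ Tendsto (fun k => ∫ y, F k y) atTop (𝓝 (∫ y, G y)) := by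
  have hbint : Integrable (K.indicator fun _ : EuclideanSpace ℝ (Fin n) => |B|) :=
    (integrableOn_const hK.measure_lt_top.ne).integrable_indicator hK.measurableSet
  have hbd : ∀ k, ∀ᵐ y, ‖F k y‖ ≤ K.indicator (fun _ => |B|) y := fun k => by
    filter_upwards [hB k] with y hy
    by_cases hyK : y ∈ K
    · rw [indicator_of_mem hyK]
      exact (hy hyK).trans (le_abs_self _)
    · rw [indicator_of_notMem hyK, h0 k y hyK, norm_zero]
  refine ⟨⟨aestronglyMeasurable_of_tendsto_ae atTop hm hlim, ?_⟩,
    tendsto_integral_of_dominated_convergence _ hm hbint hbd hlim⟩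
  exact hasFiniteIntegral_of_dominated_convergence hbint.2 hbd hlim

/-- The weak gradient of `r ^ s` is `s r ^ (s - 1) X`. -/
theorem IsBoundedWeakGradientOn.integral_rpow {Ω : Set (EuclideanSpace ℝ (Fin n))}
    (hΩ : IsOpen Ω) {r : EuclideanSpace ℝ (Fin n) → ℝ}
    {X : Fin n → EuclideanSpace ℝ (Fin n) → ℝ} (h : IsBoundedWeakGradientOn Ω r X)
    (hpos : ∀ y ∈ Ω, 0 < r y) (s : ℝ) {ξ : EuclideanSpace ℝ (Fin n) → ℝ}
    (hξ : ContDiff ℝ ∞ ξ) (hξc : HasCompactSupport ξ) (hξΩ : tsupport ξ ⊆ Ω) (i : Fin n) :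
    Integrable (fun y => s * r y ^ (s - 1) * X i y * ξ y + r y ^ s * fderiv ℝ ξ y (e i)) ∧
      ∫ y, (s * r y ^ (s - 1) * X i y * ξ y + r y ^ s * fderiv ℝ ξ y (e i)) = 0 := by
  -- The integrand is the bounded a.e. limit of the derivatives of `ψ k`, each of which has integral
  -- zero.
  obtain ⟨ψ, hψ, hψs, -, -, hψd, B, hB⟩ := h.exists_rpow_mul_approx hΩ hpos s hξ hξc hξΩ
  have hψc : ∀ k, HasCompactSupport (ψ k) := fun k =>
    IsCompact.of_isClosed_subset hξc (isClosed_tsupport _) (hψs k)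
  obtain ⟨h1, h2⟩ := tendsto_integral_of_bounded_of_isCompact hξc
    (F := fun k y => fderiv ℝ (ψ k) y (e i))
    (fun k => (((hψ k).continuous_fderiv (by norm_num)).clm_apply
      continuous_const).aestronglyMeasurable)
    (fun k y hy => by
      rw [image_eq_zero_of_notMem_tsupport fun h' => hy (hψs k (tsupport_fderiv_subset ℝ h')),
        zero_apply])
    (fun k => Eventually.of_forall fun y _ => (hB k y).2 i) (hψd.mono fun y hy => hy i)
  refine ⟨h1, tendsto_nhds_unique h2 ?_⟩
  simp only [integral_fderiv_eq_zero (hψ _) (hψc _)]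
  exact tendsto_const_nhds

/-- A distributional differential inequality `∑ᵢ ∂ᵢYⁱ ≥ H` may be tested with `r ^ s * η`. -/
theorem IsBoundedWeakGradientOn.integral_test_rpow {Ω : Set (EuclideanSpace ℝ (Fin n))}
    (hΩ : IsOpen Ω) {r : EuclideanSpace ℝ (Fin n) → ℝ}
    {X : Fin n → EuclideanSpace ℝ (Fin n) → ℝ} (h : IsBoundedWeakGradientOn Ω r X)
    (hpos : ∀ y ∈ Ω, 0 < r y) (s : ℝ) {H : EuclideanSpace ℝ (Fin n) → ℝ}
    (hH : ContinuousOn H Ω) {Y : Fin n → EuclideanSpace ℝ (Fin n) → ℝ}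
    (hYm : ∀ i, AEStronglyMeasurable (Y i) (volume.restrict Ω))
    (hYb : ∀ K ⊆ Ω, IsCompact K → ∃ B, ∀ᵐ y, y ∈ K → ∀ i, |Y i y| ≤ B)
    (hineq : ∀ ψ : EuclideanSpace ℝ (Fin n) → ℝ, ContDiff ℝ ∞ ψ → HasCompactSupport ψ →
      tsupport ψ ⊆ Ω → (∀ y, 0 ≤ ψ y) →
      ∫ y, H y * ψ y ≤ - ∫ y, ∑ i, Y i y * fderiv ℝ ψ y (e i))
    {η : EuclideanSpace ℝ (Fin n) → ℝ} (hη : ContDiff ℝ ∞ η) (hηc : HasCompactSupport η)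
    (hηΩ : tsupport η ⊆ Ω) (hη0 : ∀ y, 0 ≤ η y) :
    Integrable (fun y => H y * (r y ^ s * η y)) ∧
    Integrable (fun y => ∑ i, Y i y * (s * r y ^ (s - 1) * X i y * η y +
      r y ^ s * fderiv ℝ η y (e i))) ∧
    ∫ y, H y * (r y ^ s * η y) ≤ - ∫ y, ∑ i, Y i y * (s * r y ^ (s - 1) * X i y * η y +
      r y ^ s * fderiv ℝ η y (e i)) := by
  -- The inequality holds for each smooth nonnegative `ψ k`. Both sides converge by bounded
  -- convergence, as `H` and `Y` are bounded on the support of `η`.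
  obtain ⟨ψ, hψ, hψs, hψ0, hψl, hψd, B, hB⟩ := h.exists_rpow_mul_approx hΩ hpos s hη hηc hηΩ
  have hψc : ∀ k, HasCompactSupport (ψ k) := fun k =>
    IsCompact.of_isClosed_subset hηc (isClosed_tsupport _) (hψs k)
  have hK : IsCompact (tsupport η) := hηc
  obtain ⟨A, hA⟩ := hK.exists_bound_of_continuousOn (hH.mono hηΩ)
  obtain ⟨D, hD⟩ := hYb _ hηΩ hK
  have hmeas : ∀ {F ζ : EuclideanSpace ℝ (Fin n) → ℝ},
      AEStronglyMeasurable F (volume.restrict Ω) → Continuous ζ → (∀ y ∉ tsupport η, ζ y = 0) →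
      AEStronglyMeasurable (fun y => F y * ζ y) volume := by
    intro F ζ hF hζ h0
    have h1 : AEStronglyMeasurable (fun y => F y * ζ y) (volume.restrict Ω) :=
      hF.mul hζ.aestronglyMeasurable
    have h2 : (Ω.indicator fun y => F y * ζ y) = fun y => F y * ζ y := by
      refine indicator_eq_self.2 fun y hy => ?_
      by_contra hyΩ
      exact hy (by simp [h0 y fun h' => hyΩ (hηΩ h')])
    rw [← h2]
    exact (aestronglyMeasurable_indicator_iff hΩ.measurableSet).2 h1
  have hψz : ∀ k, ∀ y ∉ tsupport η, ψ k y = 0 := fun k y hy =>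
    image_eq_zero_of_notMem_tsupport fun h' => hy (hψs k h')
  have hψz' : ∀ k i, ∀ y ∉ tsupport η, fderiv ℝ (ψ k) y (e i) = 0 := fun k i y hy => by
    rw [image_eq_zero_of_notMem_tsupport fun h' => hy (hψs k (tsupport_fderiv_subset ℝ h')),
      zero_apply]
  obtain ⟨i1, l1⟩ := tendsto_integral_of_bounded_of_isCompact hK (F := fun k y => H y * ψ k y)
    (G := fun y => H y * (r y ^ s * η y)) (B := |A| * |B|)
    (fun k => hmeas (hH.aestronglyMeasurable hΩ.measurableSet) (hψ k).continuous (hψz k))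
    (fun k y hy => by simp [hψz k y hy])
    (fun k => Eventually.of_forall fun y hy => by
      rw [abs_mul]
      exact mul_le_mul ((hA y hy).trans (le_abs_self _)) (((hB k y).1).trans (le_abs_self _))
        (abs_nonneg _) (abs_nonneg _))
    (Eventually.of_forall fun y => (hψl y).const_mul _)
  obtain ⟨i2, l2⟩ := tendsto_integral_of_bounded_of_isCompact hK
    (F := fun k y => ∑ i, Y i y * fderiv ℝ (ψ k) y (e i))
    (G := fun y => ∑ i, Y i y * (s * r y ^ (s - 1) * X i y * η y +
      r y ^ s * fderiv ℝ η y (e i))) (B := ∑ _i : Fin n, |D| * |B|)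
    (fun k => by
      refine Finset.aestronglyMeasurable_fun_sum _ fun i _ => hmeas (hYm i) ?_ (hψz' k i)
      exact ((hψ k).continuous_fderiv (by norm_num)).clm_apply continuous_const)
    (fun k y hy => by simp [hψz' k _ y hy])
    (fun k => by
      filter_upwards [hD] with y hy hyK
      refine (Finset.abs_sum_le_sum_abs _ _).trans (Finset.sum_le_sum fun i _ => ?_)
      rw [abs_mul]
      exact mul_le_mul ((hy hyK i).trans (le_abs_self _)) (((hB k y).2 i).trans (le_abs_self _))
        (abs_nonneg _) (abs_nonneg _))
    (by
      filter_upwards [hψd] with y hy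
      exact tendsto_finsetSum _ fun i _ => (hy i).const_mul _)
  exact ⟨i1, i2, le_of_tendsto_of_tendsto' l1 l2.neg fun k =>
    hineq _ (hψ k) (hψc k) ((hψs k).trans hηΩ) (hψ0 hη0 k)⟩

end WeakGradientPower

/-! ### Moving test functions between M and a chart. -/

section TestFunctions

open Filter Topology

set_option linter.unusedSectionVars false

variable {n : ℕ} {M : Type*} [TopologicalSpace M] [T2Space M]
  [ChartedSpace (EuclideanSpace ℝ (Fin n)) M] [IsManifold (𝓡 n) ∞ M]
  {c : OpenPartialHomeomorph M (EuclideanSpace ℝ (Fin n))}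

/-- A function on `ℝⁿ` carried to `M` by a chart and extended by zero. -/
def chartLift (c : OpenPartialHomeomorph M (EuclideanSpace ℝ (Fin n)))
    (ψ : EuclideanSpace ℝ (Fin n) → ℝ) : M → ℝ :=
  c.source.indicator fun x => ψ (c x)

/-- The coordinate expression of a function on `M`, extended by zero. -/
def chartPull (c : OpenPartialHomeomorph M (EuclideanSpace ℝ (Fin n)))
    (η : M → ℝ) : EuclideanSpace ℝ (Fin n) → ℝ :=
  c.target.indicator fun y => η (c.symm y)

theorem chartLift_apply_symm {ψ : EuclideanSpace ℝ (Fin n) → ℝ} {y : EuclideanSpace ℝ (Fin n)}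
    (hy : y ∈ c.target) : chartLift c ψ (c.symm y) = ψ y := by
  rw [chartLift, indicator_of_mem (c.map_target hy), c.right_inv hy]

theorem chartPull_apply {η : M → ℝ} {y : EuclideanSpace ℝ (Fin n)}
    (hy : y ∈ c.target) : chartPull c η y = η (c.symm y) :=
  indicator_of_mem hy _

theorem fderiv_chartPull {η : M → ℝ} {y : EuclideanSpace ℝ (Fin n)} (hy : y ∈ c.target) :
    fderiv ℝ (chartPull c η) y = fderiv ℝ (fun z => η (c.symm z)) y := by
  refine Filter.EventuallyEq.fderiv_eq ?_
  filter_upwards [c.open_target.mem_nhds hy] with z hz using chartPull_apply hz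

theorem fderiv_chartLift {ψ : EuclideanSpace ℝ (Fin n) → ℝ} {y : EuclideanSpace ℝ (Fin n)}
    (hy : y ∈ c.target) :
    fderiv ℝ (fun z => chartLift c ψ (c.symm z)) y = fderiv ℝ ψ y := by
  refine Filter.EventuallyEq.fderiv_eq ?_
  filter_upwards [c.open_target.mem_nhds hy] with z hz using chartLift_apply_symm hz

/-- In a Hausdorff space the compact image of the support is closed, so extending by zero creates no
support at the boundary of the chart domain. -/
theorem tsupport_chartLift_subset {ψ : EuclideanSpace ℝ (Fin n) → ℝ} (hψc : HasCompactSupport ψ)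
    (hψ : tsupport ψ ⊆ c.target) : tsupport (chartLift c ψ) ⊆ c.symm '' tsupport ψ := by
  have hK : IsCompact (c.symm '' tsupport ψ) :=
    IsCompact.image_of_continuousOn hψc (c.continuousOn_symm.mono hψ)
  refine closure_minimal (fun x hx => ?_) hK.isClosed
  have hxs : x ∈ c.source := by
    by_contra h
    exact hx (indicator_of_notMem h _)
  have hx' : ψ (c x) ≠ 0 := by
    have := hx
    rwa [Function.mem_support, chartLift, indicator_of_mem hxs] at this
  exact ⟨c x, subset_tsupport _ hx', c.left_inv hxs⟩

theorem tsupport_chartPull_subset {η : M → ℝ} (hηc : HasCompactSupport η)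
    (hη : tsupport η ⊆ c.source) : tsupport (chartPull c η) ⊆ c '' tsupport η := by
  have hK : IsCompact (c '' tsupport η) :=
    IsCompact.image_of_continuousOn hηc (c.continuousOn.mono hη)
  refine closure_minimal (fun y hy => ?_) hK.isClosed
  have hyt : y ∈ c.target := by
    by_contra h
    exact hy (indicator_of_notMem h _)
  have hy' : η (c.symm y) ≠ 0 := by
    have := hy
    rwa [Function.mem_support, chartPull_apply hyt] at this
  exact ⟨c.symm y, subset_tsupport _ hy', c.right_inv hyt⟩

theorem isTestFunctionOn_chartLift (hc : c ∈ atlas (EuclideanSpace ℝ (Fin n)) M) {U : Set M}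
    {ψ : EuclideanSpace ℝ (Fin n) → ℝ} (hψ : ContDiff ℝ ∞ ψ) (hψc : HasCompactSupport ψ)
    (hψU : tsupport ψ ⊆ c.target ∩ c.symm ⁻¹' U) : IsTestFunctionOn n U (chartLift c ψ) := by
  have hsub := tsupport_chartLift_subset hψc (hψU.trans inter_subset_left)
  have hK : IsCompact (c.symm '' tsupport ψ) :=
    IsCompact.image_of_continuousOn hψc (c.continuousOn_symm.mono (hψU.trans inter_subset_left))
  refine ⟨?_, hK.of_isClosed_subset (isClosed_tsupport _) hsub, hsub.trans ?_⟩
  · refine contMDiff_of_tsupport fun x hx => ?_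
    obtain ⟨y, hy, rfl⟩ := hsub hx
    have hyt := c.map_target (hψU hy).1
    have h1 : ContMDiffAt (𝓡 n) (𝓡 n) ∞ c (c.symm y) :=
      contMDiffAt_of_mem_maximalAtlas (IsManifold.subset_maximalAtlas hc) hyt
    have h2 : ContMDiffAt (𝓡 n) 𝓘(ℝ, ℝ) ∞ (fun x => ψ (c x)) (c.symm y) :=
      hψ.contMDiff.contMDiffAt.comp _ h1
    refine h2.congr_of_eventuallyEq ?_
    filter_upwards [c.open_source.mem_nhds hyt] with z hz using indicator_of_mem hz _
  · rintro _ ⟨y, hy, rfl⟩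
    exact (hψU hy).2

theorem contDiff_of_contDiffAt_tsupport {f : EuclideanSpace ℝ (Fin n) → ℝ}
    (hf : ∀ y ∈ tsupport f, ContDiffAt ℝ ∞ f y) : ContDiff ℝ ∞ f :=
  (contMDiff_of_tsupport fun y hy => (hf y hy).contMDiffAt).contDiff

theorem contDiff_fderiv_apply_const {f : EuclideanSpace ℝ (Fin n) → ℝ} (hf : ContDiff ℝ ∞ f)
    (v : EuclideanSpace ℝ (Fin n)) : ContDiff ℝ ∞ fun y => fderiv ℝ f y v :=
  (hf.fderiv_right (by norm_num)).clm_apply contDiff_const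

/-- The differential of a function vanishes off its topological support. -/
theorem mvfderiv_apply_of_notMem_tsupport {η : M → ℝ} {x : M} (hx : x ∉ tsupport η)
    (v : TangentSpace (𝓡 n) x) : mvfderiv (𝓡 n) η x v = 0 := by
  have h : η =ᶠ[𝓝 x] fun _ => 0 := notMem_tsupport_iff_eventuallyEq.1 hx
  change (mfderiv (𝓡 n) 𝓘(ℝ, ℝ) η x) v = (0 : ℝ)
  rw [h.mfderiv_eq, mfderiv_const]
  rfl

theorem contDiff_chartPull (hc : c ∈ atlas (EuclideanSpace ℝ (Fin n)) M) {U : Set M}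
    {η : M → ℝ} (hη : IsTestFunctionOn n U η) (hηc : tsupport η ⊆ c.source) :
    ContDiff ℝ ∞ (chartPull c η) ∧ HasCompactSupport (chartPull c η) ∧
      tsupport (chartPull c η) ⊆ c.target ∩ c.symm ⁻¹' U := by
  have hsub := tsupport_chartPull_subset hη.compact_support hηc
  have hK : IsCompact (c '' tsupport η) :=
    IsCompact.image_of_continuousOn hη.compact_support (c.continuousOn.mono hηc)
  have hsub' : c '' tsupport η ⊆ c.target ∩ c.symm ⁻¹' U := by
    rintro _ ⟨x, hx, rfl⟩
    refine ⟨c.map_source (hηc hx), ?_⟩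
    rw [mem_preimage, c.left_inv (hηc hx)]
    exact hη.support_subset hx
  refine ⟨?_, hK.of_isClosed_subset (isClosed_tsupport _) hsub, hsub.trans hsub'⟩
  refine contDiff_of_contDiffAt_tsupport fun y hy => ?_
  have hyt := (hsub' (hsub hy)).1
  refine ((contDiffOn_comp_symm hc hη.smooth).contDiffAt
    (c.open_target.mem_nhds hyt)).congr_of_eventuallyEq ?_
  filter_upwards [c.open_target.mem_nhds hyt] with z hz using chartPull_apply hz

theorem contDiff_mul_of_tsupport_subset {O : Set (EuclideanSpace ℝ (Fin n))} (hO : IsOpen O)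
    {η W : EuclideanSpace ℝ (Fin n) → ℝ} (hη : ContDiff ℝ ∞ η) (hηO : tsupport η ⊆ O)
    (hW : ContDiffOn ℝ ∞ W O) : ContDiff ℝ ∞ fun y => η y * W y := by
  refine contDiff_of_contDiffAt_tsupport fun y hy => ?_
  have hyO : y ∈ O := hηO (tsupport_mul_subset_left hy)
  exact hη.contDiffAt.mul (hW.contDiffAt (hO.mem_nhds hyO))

end TestFunctions

/-! ### The divergence is independent of the chart. -/

section Divergence

open Filter Topology

set_option linter.unusedSectionVars false

variable {n : ℕ} {M : Type*} [TopologicalSpace M]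
  [ChartedSpace (EuclideanSpace ℝ (Fin n)) M] [IsManifold (𝓡 n) ∞ M]
  [T2Space M] [SigmaCompactSpace M] [MeasurableSpace M] [BorelSpace M]
  {c c' : OpenPartialHomeomorph M (EuclideanSpace ℝ (Fin n))}

/-- The divergence computed in the chart `c`. -/
def divIn (g : Metric n M) (c : OpenPartialHomeomorph M (EuclideanSpace ℝ (Fin n)))
    (X : (x : M) → TangentSpace (𝓡 n) x) (x : M) : ℝ :=
  (volDensity g c (c x))⁻¹ *
    ∑ i : Fin n, fderiv ℝ (fun y => volDensity g c y * coordComp c X i y) (c x) (e i)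

/-- The components of `X` in every chart of the atlas are smooth. -/
def SmoothComponents (X : (x : M) → TangentSpace (𝓡 n) x) : Prop :=
  ∀ c ∈ atlas (EuclideanSpace ℝ (Fin n)) M, ∀ i, ContDiffOn ℝ ∞ (coordComp c X i) c.target

theorem smoothComponents_grad (g : Metric n M) {f : M → ℝ}
    (hf : ContMDiff (𝓡 n) 𝓘(ℝ, ℝ) ∞ f) : SmoothComponents (grad g f) :=
  fun _ hc i => contDiffOn_coordComp_grad g hc hf i

variable {X : (x : M) → TangentSpace (𝓡 n) x}

theorem contDiffOn_density_mul (g : Metric n M) (hX : SmoothComponents X)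
    (hc : c ∈ atlas (EuclideanSpace ℝ (Fin n)) M) (i : Fin n) :
    ContDiffOn ℝ ∞ (fun y => volDensity g c y * coordComp c X i y) c.target :=
  (contDiffOn_volDensity g hc).mul (hX c hc i)

theorem continuousOn_divIn (g : Metric n M) (hX : SmoothComponents X)
    (hc : c ∈ atlas (EuclideanSpace ℝ (Fin n)) M) : ContinuousOn (divIn g c X) c.source := by
  have h1 : ContinuousOn (fun y => (volDensity g c y)⁻¹ * ∑ i : Fin n,
      fderiv ℝ (fun y => volDensity g c y * coordComp c X i y) y (e i)) c.target :=
    ((contDiffOn_volDensity g hc).continuousOn.inv₀ fun y hy => (volDensity_pos g hc hy).ne').mul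
      (continuousOn_finsetSum _ fun i _ => (contDiffOn_fderiv_apply c.open_target
        (contDiffOn_density_mul g hX hc i) (e i)).continuousOn)
  exact h1.comp c.continuousOn c.mapsTo

/-- The divergence computed in a chart is dual to the differential. -/
theorem integral_mul_divIn (g : Metric n M) (hX : SmoothComponents X)
    (hc : c ∈ atlas (EuclideanSpace ℝ (Fin n)) M) {η : M → ℝ} (hη : IsTestFunctionOn n univ η)
    (hηc : tsupport η ⊆ c.source) :
    Integrable (fun x => η x * divIn g c X x) (riemannianVolume g) ∧
    ∫ x, η x * divIn g c X x ∂riemannianVolume g =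
      - ∫ x, mvfderiv (𝓡 n) η x (X x) ∂riemannianVolume g := by
  obtain ⟨hs, hcs, hts⟩ := contDiff_chartPull hc hη hηc
  set ξ := chartPull c η with hξ
  have hts' : tsupport ξ ⊆ c.target := hts.trans inter_subset_left
  set W : Fin n → EuclideanSpace ℝ (Fin n) → ℝ :=
    fun i y => volDensity g c y * coordComp c X i y with hW
  have hWs : ∀ i, ContDiffOn ℝ ∞ (W i) c.target := contDiffOn_density_mul g hX hc
  have hprod : ∀ i, ContDiff ℝ ∞ fun y => ξ y * W i y := fun i =>
    contDiff_mul_of_tsupport_subset c.open_target hs hts' (hWs i)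
  have hprodc : ∀ i, HasCompactSupport fun y => ξ y * W i y := fun i => hcs.mul_right
  have hi1 : ∀ i, Integrable fun y => ξ y * fderiv ℝ (W i) y (e i) := fun i =>
    (contDiff_mul_of_tsupport_subset c.open_target hs hts'
      (contDiffOn_fderiv_apply c.open_target (hWs i) (e i))).continuous.integrable_of_hasCompactSupport
      hcs.mul_right
  have hi2 : ∀ i, Integrable fun y => fderiv ℝ ξ y (e i) * W i y := fun i =>
    (contDiff_mul_of_tsupport_subset c.open_target (contDiff_fderiv_apply_const hs (e i))
      ((tsupport_fderiv_apply_subset ℝ (e i)).trans hts') (hWs i)).continuous.integrable_of_hasCompactSupport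
      (hcs.fderiv_apply (𝕜 := ℝ) (e i)).mul_right
  have hzero : ∀ y ∉ c.target, ξ y = 0 ∧ ∀ i, fderiv ℝ ξ y (e i) = 0 := fun y hy =>
    ⟨image_eq_zero_of_notMem_tsupport fun h => hy (hts' h), fun i => by
      rw [image_eq_zero_of_notMem_tsupport fun h => hy (hts' (tsupport_fderiv_subset ℝ h)),
        zero_apply]⟩
  -- With the density absorbed in `W`, and cancelled against its inverse in `divIn`, the duality is
  -- the Euclidean integration by parts in each coordinate.
  have hparts : ∀ i, ∫ y, ξ y * fderiv ℝ (W i) y (e i) = - ∫ y, fderiv ℝ ξ y (e i) * W i y := by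
    intro i
    have h0 := integral_fderiv_eq_zero (hprod i) (hprodc i) (e i)
    have hd : ∀ y, fderiv ℝ (fun y => ξ y * W i y) y (e i) =
        ξ y * fderiv ℝ (W i) y (e i) + fderiv ℝ ξ y (e i) * W i y := by
      intro y
      by_cases hy : y ∈ c.target
      · rw [fderiv_fun_mul (hs.differentiable (by norm_num) y)
          (((hWs i).contDiffAt (c.open_target.mem_nhds hy)).differentiableAt (by norm_num))]
        simp only [add_apply, smul_apply, smul_eq_mul]
        ring
      · have h1 : fderiv ℝ (fun y => ξ y * W i y) y = 0 :=
          image_eq_zero_of_notMem_tsupport fun h => hy (hts' (tsupport_mul_subset_left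
            (tsupport_fderiv_subset ℝ h)))
        rw [h1, (hzero y hy).1, (hzero y hy).2]
        simp
    simp only [hd] at h0
    rw [integral_add (hi1 i) (hi2 i)] at h0
    linarith
  have hdiff : MDifferentiable (𝓡 n) 𝓘(ℝ, ℝ) η := hη.smooth.mdifferentiable (by simp)
  have e1 : ∀ y ∈ c.target, volDensity g c y * (η (c.symm y) * divIn g c X (c.symm y)) =
      ∑ i, ξ y * fderiv ℝ (W i) y (e i) := by
    intro y hy
    rw [divIn, c.right_inv hy, hξ, chartPull_apply hy, ← Finset.mul_sum]
    rw [mul_left_comm (volDensity g c y), mul_inv_cancel_left₀ (volDensity_pos g hc hy).ne']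
  have e2 : ∀ y ∈ c.target, volDensity g c y * mvfderiv (𝓡 n) η (c.symm y) (X (c.symm y)) =
      ∑ i, fderiv ℝ ξ y (e i) * W i y := by
    intro y hy
    rw [mvfderiv_eq_sum_coordComp hc hy (hdiff _), Finset.mul_sum]
    refine Finset.sum_congr rfl fun i _ => ?_
    rw [hξ, fderiv_chartPull hy, hW]
    ring
  have i1 : IntegrableOn (fun y => volDensity g c y * (η (c.symm y) * divIn g c X (c.symm y)))
      c.target :=
    ((integrable_finsetSum _ fun i _ => hi1 i).integrableOn).congr_fun
      (fun y hy => (e1 y hy).symm) c.open_target.measurableSet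
  have i2 : IntegrableOn (fun y => volDensity g c y *
      mvfderiv (𝓡 n) η (c.symm y) (X (c.symm y))) c.target :=
    ((integrable_finsetSum _ fun i _ => hi2 i).integrableOn).congr_fun
      (fun y hy => (e2 y hy).symm) c.open_target.measurableSet
  have z1 : ∀ x ∉ c.source, η x * divIn g c X x = 0 := fun x hx => by
    rw [image_eq_zero_of_notMem_tsupport fun h => hx (hηc h), zero_mul]
  have z2 : ∀ x ∉ c.source, mvfderiv (𝓡 n) η x (X x) = 0 := fun x hx =>
    mvfderiv_apply_of_notMem_tsupport (fun h => hx (hηc h)) _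
  obtain ⟨j1, k1⟩ := integrable_and_integral_eq_chart g hc z1 i1
  obtain ⟨j2, k2⟩ := integrable_and_integral_eq_chart g hc z2 i2
  refine ⟨j1, ?_⟩
  rw [k1, k2, setIntegral_congr_fun c.open_target.measurableSet e1,
    setIntegral_congr_fun c.open_target.measurableSet e2,
    setIntegral_eq_integral_of_forall_compl_eq_zero fun y hy => by simp [(hzero y hy).1],
    setIntegral_eq_integral_of_forall_compl_eq_zero fun y hy => by simp [(hzero y hy).2],
    integral_finsetSum _ fun i _ => hi1 i, integral_finsetSum _ fun i _ => hi2 i]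
  simp only [hparts, Finset.sum_neg_distrib]

/-- The divergence does not depend on the chart. -/
theorem divIn_eqOn (g : Metric n M) (hX : SmoothComponents X)
    (hc : c ∈ atlas (EuclideanSpace ℝ (Fin n)) M) (hc' : c' ∈ atlas (EuclideanSpace ℝ (Fin n)) M) :
    EqOn (divIn g c X) (divIn g c' X) (c.source ∩ c'.source) := by
  have hO : IsOpen (c.source ∩ c'.source) := c.open_source.inter c'.open_source
  have hf : ContinuousOn (divIn g c X) (c.source ∩ c'.source) :=
    (continuousOn_divIn g hX hc).mono inter_subset_left
  have hf' : ContinuousOn (divIn g c' X) (c.source ∩ c'.source) :=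
    (continuousOn_divIn g hX hc').mono inter_subset_right
  have : LocallyCompactSpace M := ChartedSpace.locallyCompactSpace (EuclideanSpace ℝ (Fin n)) M
  have : SecondCountableTopology M :=
    ChartedSpace.secondCountable_of_sigmaCompact (EuclideanSpace ℝ (Fin n)) M
  -- By `integral_mul_divIn` both expressions have the same pairing with each test function on the
  -- overlap, a pairing in which no chart appears. Hence they agree a.e., and everywhere by
  -- continuity.
  have h := hO.ae_eq_zero_of_integral_contMDiff_smul_eq_zero (𝓡 n)
    (μ := riemannianVolume g) (f := fun x => divIn g c X x - divIn g c' X x)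
    ((hf.sub hf').locallyIntegrableOn hO.measurableSet) fun η hη hηc hηs => by
      have ht : IsTestFunctionOn n univ η := ⟨hη, hηc, subset_univ _⟩
      obtain ⟨i1, j1⟩ := integral_mul_divIn g hX hc ht (hηs.trans inter_subset_left)
      obtain ⟨i2, j2⟩ := integral_mul_divIn g hX hc' ht (hηs.trans inter_subset_right)
      simp only [smul_eq_mul, mul_sub]
      rw [integral_sub i1 i2, j1, j2, sub_self]
  refine Measure.eqOn_open_of_ae_eq (μ := riemannianVolume g) ?_ hO hf hf'
  rw [EventuallyEq, ae_restrict_iff' hO.measurableSet]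
  filter_upwards [h] with x hx hxO
  exact sub_eq_zero.1 (hx hxO)

/-- The definition of `div` changes chart with the point; continuity and integration by parts
require one chart fixed on a whole open set. -/
theorem div_eq_divIn (g : Metric n M) (hX : SmoothComponents X)
    (hc : c ∈ atlas (EuclideanSpace ℝ (Fin n)) M) {x : M} (hx : x ∈ c.source) :
    div g X x = divIn g c X x :=
  divIn_eqOn g hX (chart_mem_atlas _ x) hc ⟨mem_chart_source _ x, hx⟩

theorem continuous_div (g : Metric n M) (hX : SmoothComponents X) : Continuous (div g X) := by
  refine continuous_iff_continuousAt.2 fun x => ?_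
  have hc := chart_mem_atlas (EuclideanSpace ℝ (Fin n)) x
  have hs := (chartAt (EuclideanSpace ℝ (Fin n)) x).open_source.mem_nhds (mem_chart_source _ x)
  refine ((continuousOn_divIn g hX hc).continuousAt hs).congr ?_
  filter_upwards [hs] with z hz using (div_eq_divIn g hX hc hz).symm

end Divergence

/-! ### The eikonal bound and the divergence form of the affine Laplacian. -/

section LocalIdentities

open Filter Topology

set_option linter.unusedSectionVars false

variable {n : ℕ} {M : Type*} [TopologicalSpace M]
  [ChartedSpace (EuclideanSpace ℝ (Fin n)) M] [IsManifold (𝓡 n) ∞ M]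
  [T2Space M] [SigmaCompactSpace M] [MeasurableSpace M] [BorelSpace M]
  {c : OpenPartialHomeomorph M (EuclideanSpace ℝ (Fin n))}

theorem inner_sq_le (g : Metric n M) (x : M) (v w : TangentSpace (𝓡 n) x) :
    g.inner x v w ^ 2 ≤ g.inner x v v * g.inner x w w := by
  refine (form g x).apply_sq_le_of_symm (fun z => ?_) ⟨fun a b => g.symm x a b⟩ v w
  by_cases hz : z = 0
  · simp [hz]
  · exact (g.pos x z hz).le

theorem inner_self_nonneg (g : Metric n M) (x : M) (v : TangentSpace (𝓡 n) x) :
    0 ≤ g.inner x v v := by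
  by_cases hz : v = 0
  · simp [hz]
  · exact (g.pos x v hz).le

theorem exp_rpow_mul_exp_rpow (t a b : ℝ) :
    Real.exp t ^ a * Real.exp t ^ b = Real.exp t ^ (a + b) :=
  (Real.rpow_add (Real.exp_pos t) a b).symm

/-- The eikonal equation `|V^{μ-λ} X| = 1`, solved for `V^{μ-λ} |X|²`. -/
theorem mul_inner_self_of_norm_affineScale (g : Metric n M) {u : M → ℝ} {lam mu : ℝ}
    {X : (x : M) → TangentSpace (𝓡 n) x} {x : M}
    (h : norm g x (affineScale u lam mu X x) = 1) :
    Real.exp (u x) ^ (mu - lam) * g.inner x (X x) (X x) = Real.exp (u x) ^ (lam - mu) := by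
  rw [norm, Real.sqrt_eq_one, affineScale] at h
  simp only [map_smul, smul_apply, smul_eq_mul] at h
  have h2 : Real.exp (u x) ^ (lam - mu) * Real.exp (u x) ^ (mu - lam) = 1 := by
    rw [exp_rpow_mul_exp_rpow]; simp
  calc _ = (Real.exp (u x) ^ (lam - mu) * Real.exp (u x) ^ (mu - lam)) *
      (Real.exp (u x) ^ (mu - lam) * g.inner x (X x) (X x)) := by rw [h2, one_mul]
    _ = Real.exp (u x) ^ (lam - mu) * (Real.exp (u x) ^ (mu - lam) *
      (Real.exp (u x) ^ (mu - lam) * g.inner x (X x) (X x))) := by ring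
    _ = _ := by rw [h, mul_one]

theorem continuousOn_exp_rpow_chart (c : OpenPartialHomeomorph M (EuclideanSpace ℝ (Fin n)))
    {u : M → ℝ} (hu : Continuous u) (t : ℝ) :
    ContinuousOn (fun y => Real.exp (u (c.symm y)) ^ t) c.target := by
  refine ((hu.rexp.rpow_const fun x => Or.inl (Real.exp_ne_zero _)).comp_continuousOn
    c.continuousOn_symm)

/-- In a chart, a weak gradient with `|V^{μ-λ} X| = 1` is locally bounded. -/
theorem IsWeakGradientOn.isBoundedWeakGradientOn {g : Metric n M} {U : Set M} (hU : IsOpen U)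
    {u ρ : M → ℝ} (hu : Continuous u) (hρ : Continuous ρ) {lam mu : ℝ}
    {X : (x : M) → TangentSpace (𝓡 n) x} (hX : IsWeakGradientOn g U ρ X)
    (hX_norm : ∀ᵐ x ∂((riemannianVolume g).restrict U), norm g x (affineScale u lam mu X x) = 1)
    {p : M} (hcp : c = chartAt (EuclideanSpace ℝ (Fin n)) p) :
    IsBoundedWeakGradientOn (c.target ∩ c.symm ⁻¹' U) (fun y => ρ (c.symm y))
      (lowerComp g c X) where
  continuousOn := hρ.comp_continuousOn (c.continuousOn_symm.mono inter_subset_left)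
  locallyIntegrableOn i := by
    subst hcp
    exact hX.locallyIntegrable_grad p i
  weak_deriv i ψ h1 h2 h3 := by
    subst hcp
    exact hX.weak_deriv p i ψ h1 h2 h3
  bounded K hK hKc := by
    have hc : c ∈ atlas (EuclideanSpace ℝ (Fin n)) M := hcp ▸ chart_mem_atlas _ p
    have hae := ae_chart_of_ae_restrict g hc hU.measurableSet hX_norm
    have hKt : K ⊆ c.target := hK.trans inter_subset_left
    -- The bounded quantity is |X|² g_{ii}, since |X|² = V^{2(λ-μ)} a.e.; by Cauchy–Schwarz it
    -- dominates the square of the covariant component.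
    have hb : ∀ i, ∃ B, ∀ y ∈ K, ‖Real.exp (u (c.symm y)) ^ (lam - mu) *
        Real.exp (u (c.symm y)) ^ (lam - mu) * gram g c y i i‖ ≤ B := fun i =>
      hKc.exists_bound_of_continuousOn
        ((((continuousOn_exp_rpow_chart c hu _).mul (continuousOn_exp_rpow_chart c hu _)).mul
          (contDiffOn_gram g hc i i).continuousOn).mono hKt)
    choose B hB using hb
    refine ⟨∑ i, √|B i|, ?_⟩
    filter_upwards [hae] with y hy hyK i
    have h1 := mul_inner_self_of_norm_affineScale g (hy (hK hyK))
    have h2 := inner_sq_le g (c.symm y) (X (c.symm y)) (coordVec c i y)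
    have h3 : g.inner (c.symm y) (X (c.symm y)) (X (c.symm y)) =
        Real.exp (u (c.symm y)) ^ (lam - mu) * Real.exp (u (c.symm y)) ^ (lam - mu) := by
      conv_rhs => enter [2]; rw [← h1]
      rw [← mul_assoc, exp_rpow_mul_exp_rpow]
      simp
    have h4 : lowerComp g c X i y ^ 2 ≤ |B i| := by
      refine h2.trans ?_
      rw [h3]
      exact (le_abs_self _).trans ((hB i y hyK).trans (le_abs_self _))
    have h5 : |lowerComp g c X i y| ≤ √|B i| := Real.abs_le_sqrt h4
    exact h5.trans (Finset.single_le_sum (f := fun i => √|B i|)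
      (fun j _ => Real.sqrt_nonneg _) (Finset.mem_univ i))

/-- The contravariant components are measurable and locally bounded if the covariant ones are. -/
theorem IsBoundedWeakGradientOn.coordComp_bounded {g : Metric n M}
    (hc : c ∈ atlas (EuclideanSpace ℝ (Fin n)) M) {Ω : Set (EuclideanSpace ℝ (Fin n))}
    (hΩ : IsOpen Ω) (hΩc : Ω ⊆ c.target) {r : EuclideanSpace ℝ (Fin n) → ℝ}
    {X : (x : M) → TangentSpace (𝓡 n) x} (h : IsBoundedWeakGradientOn Ω r (lowerComp g c X))
    {w : EuclideanSpace ℝ (Fin n) → ℝ} (hw : ContinuousOn w Ω) :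
    (∀ i, AEStronglyMeasurable (fun y => w y * coordComp c X i y) (volume.restrict Ω)) ∧
    ∀ K ⊆ Ω, IsCompact K → ∃ B, ∀ᵐ y, y ∈ K → ∀ i, |w y * coordComp c X i y| ≤ B := by
  have hG : ∀ i j, ContinuousOn (fun y => w y * (gram g c y)⁻¹ i j) Ω := fun i j =>
    hw.mul ((contDiffOn_gram_inv g hc i j).continuousOn.mono hΩc)
  have heq : ∀ y ∈ Ω, ∀ i, w y * coordComp c X i y =
      ∑ j, (w y * (gram g c y)⁻¹ i j) * lowerComp g c X j y := fun y hy i => by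
    rw [coordComp_eq_sum g hc (hΩc hy), Finset.mul_sum]
    exact Finset.sum_congr rfl fun j _ => (mul_assoc _ _ _).symm
  constructor
  · intro i
    have h1 : AEStronglyMeasurable (fun y => ∑ j, (w y * (gram g c y)⁻¹ i j) *
        lowerComp g c X j y) (volume.restrict Ω) :=
      Finset.aestronglyMeasurable_fun_sum _ fun j _ =>
        ((hG i j).aestronglyMeasurable hΩ.measurableSet).mul
          (h.locallyIntegrableOn j).aestronglyMeasurable
    refine h1.congr ?_
    filter_upwards [ae_restrict_mem hΩ.measurableSet] with y hy using (heq y hy i).symm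
  · intro K hK hKc
    have hb : ∀ i j, ∃ B, ∀ y ∈ K, ‖w y * (gram g c y)⁻¹ i j‖ ≤ B := fun i j =>
      hKc.exists_bound_of_continuousOn ((hG i j).mono hK)
    choose A hA using hb
    obtain ⟨B, hB⟩ := h.bounded K hK hKc
    refine ⟨∑ i, ∑ j, |A i j| * |B|, ?_⟩
    filter_upwards [hB] with y hy hyK i
    rw [heq y (hK hyK)]
    refine (Finset.abs_sum_le_sum_abs _ _).trans ?_
    refine le_trans ?_ (Finset.single_le_sum (f := fun i => ∑ j, |A i j| * |B|)
      (fun j _ => Finset.sum_nonneg fun k _ => by positivity) (Finset.mem_univ i))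
    refine Finset.sum_le_sum fun j _ => ?_
    rw [abs_mul]
    exact mul_le_mul ((hA i j y hyK).trans (le_abs_self _)) ((hy hyK j).trans (le_abs_self _))
      (abs_nonneg _) (abs_nonneg _)

/-- The affine Laplacian in divergence form, in a chart. -/
theorem affineLaplacian_chart (g : Metric n M) (hc : c ∈ atlas (EuclideanSpace ℝ (Fin n)) M)
    {u φ : M → ℝ} (hu : ContMDiff (𝓡 n) 𝓘(ℝ, ℝ) ∞ u) (hφ : ContMDiff (𝓡 n) 𝓘(ℝ, ℝ) ∞ φ)
    (lam mu : ℝ) {y : EuclideanSpace ℝ (Fin n)} (hy : y ∈ c.target) :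
    volDensity g c y * (affineLaplacian g u lam mu φ (c.symm y) *
        Real.exp (u (c.symm y)) ^ ((n + 1) * lam + mu)) =
      ∑ i, fderiv ℝ (fun z => Real.exp (u (c.symm z)) ^ (2 * mu + n * lam) *
        (volDensity g c z * coordComp c (grad g φ) i z)) y (e i) := by
  have hX := smoothComponents_grad g hφ
  set W : Fin n → EuclideanSpace ℝ (Fin n) → ℝ :=
    fun i z => volDensity g c z * coordComp c (grad g φ) i z with hW
  have hWs : ∀ i, ContDiffOn ℝ ∞ (W i) c.target := contDiffOn_density_mul g hX hc
  -- This exponent is at once the drift coefficient in the affine Laplacian and the sum of μ-λ and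
  -- τ. The coincidence makes V^τ Δ^Dφ the Riemannian divergence of V^σ ∇φ.
  set σ : ℝ := 2 * mu + n * lam with hσ
  have hd : ∀ i, fderiv ℝ (fun z => Real.exp (u (c.symm z)) ^ σ * W i z) y (e i) =
      Real.exp (u (c.symm y)) ^ σ * fderiv ℝ (W i) y (e i) +
        Real.exp (u (c.symm y)) ^ σ * (σ * fderiv ℝ (fun z => u (c.symm z)) y (e i)) * W i y := by
    intro i
    have h1 : HasFDerivAt (fun z => u (c.symm z)) (fderiv ℝ (fun z => u (c.symm z)) y) y :=
      (((contDiffOn_comp_symm hc hu).contDiffAt (c.open_target.mem_nhds hy)).differentiableAt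
        (by norm_num)).hasFDerivAt
    have h2 := (h1.mul_const σ).exp
    simp only [Real.exp_mul] at h2
    have h3 : HasFDerivAt (W i) (fderiv ℝ (W i) y) y :=
      (((hWs i).contDiffAt (c.open_target.mem_nhds hy)).differentiableAt (by norm_num)).hasFDerivAt
    rw [(h2.fun_mul h3).fderiv]
    simp only [add_apply, smul_apply, smul_eq_mul]
    ring
  have hdiv : volDensity g c y * laplacian g φ (c.symm y) = ∑ i, fderiv ℝ (W i) y (e i) := by
    rw [laplacian, div_eq_divIn g hX hc (c.map_target hy), divIn, c.right_inv hy,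
      mul_inv_cancel_left₀ (volDensity_pos g hc hy).ne']
  have hinner : volDensity g c y * g.inner (c.symm y) (grad g u (c.symm y)) (grad g φ (c.symm y)) =
      ∑ i, fderiv ℝ (fun z => u (c.symm z)) y (e i) * W i y := by
    rw [inner_grad, mvfderiv_eq_sum_coordComp hc hy (hu.mdifferentiableAt (by simp)),
      Finset.mul_sum]
    exact Finset.sum_congr rfl fun i _ => by rw [hW]; ring
  have hexp : Real.exp (u (c.symm y)) ^ (mu - lam) *
      Real.exp (u (c.symm y)) ^ ((n + 1) * lam + mu) = Real.exp (u (c.symm y)) ^ σ := by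
    rw [exp_rpow_mul_exp_rpow]
    congr 1
    rw [hσ]; ring
  calc _ = (Real.exp (u (c.symm y)) ^ (mu - lam) *
        Real.exp (u (c.symm y)) ^ ((n + 1) * lam + mu)) *
        (volDensity g c y * laplacian g φ (c.symm y) + σ * (volDensity g c y *
          g.inner (c.symm y) (grad g u (c.symm y)) (grad g φ (c.symm y)))) := by
        rw [affineLaplacian]; ring
    _ = _ := by
        rw [hexp, hdiv, hinner]
        refine Eq.trans ?_ (Finset.sum_congr rfl fun i _ => (hd i).symm)
        rw [Finset.sum_add_distrib, mul_add, Finset.mul_sum, Finset.mul_sum, Finset.mul_sum]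
        congr 1
        exact Finset.sum_congr rfl fun i _ => by ring

end LocalIdentities

/-! ### The two integrations by parts within one chart. -/

section LocalWeakForms

open Filter Topology

set_option linter.unusedSectionVars false

variable {n : ℕ} {M : Type*} [TopologicalSpace M]
  [ChartedSpace (EuclideanSpace ℝ (Fin n)) M] [IsManifold (𝓡 n) ∞ M]
  [T2Space M] [SigmaCompactSpace M] [MeasurableSpace M] [BorelSpace M]
  {c : OpenPartialHomeomorph M (EuclideanSpace ℝ (Fin n))}

theorem exp_rpow_mul_rpow_weight (n : ℕ) (t lam mu : ℝ) :
    Real.exp t ^ (mu - lam) * Real.exp t ^ ((n + 1) * lam + mu) =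
      Real.exp t ^ (2 * mu + n * lam) := by
  rw [exp_rpow_mul_exp_rpow]
  congr 1
  ring

/-- Integration by parts for the affine Laplacian of `φ` against `ρ ^ q * η`, with `η` supported
in a chart. -/
theorem integral_affineLaplacian_chart {g : Metric n M}
    (hc : c ∈ atlas (EuclideanSpace ℝ (Fin n)) M) {U : Set M} (hU : IsOpen U)
    {u ρ φ η : M → ℝ} (hu : ContMDiff (𝓡 n) 𝓘(ℝ, ℝ) ∞ u) (hφ : ContMDiff (𝓡 n) 𝓘(ℝ, ℝ) ∞ φ)
    (hpos : ∀ x ∈ U, 0 < ρ x) {X : (x : M) → TangentSpace (𝓡 n) x}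
    (h : IsBoundedWeakGradientOn (c.target ∩ c.symm ⁻¹' U) (fun y => ρ (c.symm y))
      (lowerComp g c X))
    (hη : IsTestFunctionOn n U η) (hηc : tsupport η ⊆ c.source) (lam mu q : ℝ)
    {A : M → ℝ} {Z : (x : M) → TangentSpace (𝓡 n) x}
    (hA : ∀ x, A x = (ρ x ^ q * affineLaplacian g u lam mu φ x + q * ρ x ^ (q - 1) *
      (Real.exp (u x) ^ (mu - lam) * g.inner x (X x) (grad g φ x))) *
        Real.exp (u x) ^ ((n + 1) * lam + mu))
    (hZ : ∀ x, Z x = (ρ x ^ q * Real.exp (u x) ^ (mu - lam) *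
      Real.exp (u x) ^ ((n + 1) * lam + mu)) • grad g φ x) :
    Integrable (fun x => A x * η x + mvfderiv (𝓡 n) η x (Z x)) (riemannianVolume g) ∧
      ∫ x, (A x * η x + mvfderiv (𝓡 n) η x (Z x)) ∂riemannianVolume g = 0 := by
  obtain ⟨hs, hcs, hts⟩ := contDiff_chartPull hc hη hηc
  set ξ := chartPull c η with hξ
  have hts' : tsupport ξ ⊆ c.target := hts.trans inter_subset_left
  have hΩ : IsOpen (c.target ∩ c.symm ⁻¹' U) := c.isOpen_inter_preimage_symm hU
  have hX := smoothComponents_grad g hφ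
  set W : Fin n → EuclideanSpace ℝ (Fin n) → ℝ :=
    fun i z => Real.exp (u (c.symm z)) ^ (2 * mu + n * lam) *
      (volDensity g c z * coordComp c (grad g φ) i z) with hW
  have hWs : ∀ i, ContDiffOn ℝ ∞ (W i) c.target := fun i =>
    ((contDiffOn_comp_symm hc hu).exp.rpow_const_of_ne fun y _ => Real.exp_ne_zero _).mul
      (contDiffOn_density_mul g hX hc i)
  have hprod : ∀ i, ContDiff ℝ ∞ fun y => ξ y * W i y := fun i =>
    contDiff_mul_of_tsupport_subset c.open_target hs hts' (hWs i)
  -- The weak i-th partial derivative of ρ^q is tested with `ξ * W i`, `W` being the weighted flux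
  -- of ∇φ; the sum over i is the stated identity.
  have key := fun i => h.integral_rpow hΩ (fun y hy => hpos _ hy.2) q (hprod i) hcs.mul_right
    (tsupport_mul_subset_left.trans hts) i
  have hηd : MDifferentiable (𝓡 n) 𝓘(ℝ, ℝ) η := hη.smooth.mdifferentiable (by simp)
  have hd : ∀ i, ∀ y ∈ c.target, fderiv ℝ (fun y => ξ y * W i y) y (e i) =
      ξ y * fderiv ℝ (W i) y (e i) + fderiv ℝ ξ y (e i) * W i y := by
    intro i y hy
    rw [fderiv_fun_mul (hs.differentiable (by norm_num) y)
      (((hWs i).contDiffAt (c.open_target.mem_nhds hy)).differentiableAt (by norm_num))]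
    simp only [add_apply, smul_apply, smul_eq_mul]
    ring
  have e1 : ∀ y ∈ c.target, volDensity g c y * (A (c.symm y) * η (c.symm y) +
      mvfderiv (𝓡 n) η (c.symm y) (Z (c.symm y))) =
      ∑ i, (q * ρ (c.symm y) ^ (q - 1) * lowerComp g c X i y * (ξ y * W i y) +
        ρ (c.symm y) ^ q * fderiv ℝ (fun y => ξ y * W i y) y (e i)) := by
    intro y hy
    have h1 := affineLaplacian_chart g hc hu hφ lam mu hy
    have h2 : volDensity g c y * (Real.exp (u (c.symm y)) ^ (2 * mu + n * lam) *
        g.inner (c.symm y) (X (c.symm y)) (grad g φ (c.symm y))) =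
        ∑ i, lowerComp g c X i y * W i y := by
      rw [g.symm, inner_eq_sum_coordComp g hc hy, Finset.mul_sum, Finset.mul_sum]
      exact Finset.sum_congr rfl fun i _ => by rw [hW]; ring
    have h3 : volDensity g c y * (Real.exp (u (c.symm y)) ^ (2 * mu + n * lam) *
        mvfderiv (𝓡 n) η (c.symm y) (grad g φ (c.symm y))) =
        ∑ i, fderiv ℝ ξ y (e i) * W i y := by
      rw [mvfderiv_eq_sum_coordComp hc hy (hηd _), Finset.mul_sum, Finset.mul_sum]
      exact Finset.sum_congr rfl fun i _ => by rw [hξ, fderiv_chartPull hy, hW]; ring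
    rw [hA, hZ, map_smul, smul_eq_mul, mul_assoc (ρ (c.symm y) ^ q), exp_rpow_mul_rpow_weight]
    simp only [hd _ y hy]
    calc _ = ρ (c.symm y) ^ q * ξ y * (volDensity g c y *
          (affineLaplacian g u lam mu φ (c.symm y) *
            Real.exp (u (c.symm y)) ^ ((n + 1) * lam + mu))) +
          q * ρ (c.symm y) ^ (q - 1) * ξ y * (volDensity g c y *
            ((Real.exp (u (c.symm y)) ^ (mu - lam) *
              Real.exp (u (c.symm y)) ^ ((n + 1) * lam + mu)) *
            g.inner (c.symm y) (X (c.symm y)) (grad g φ (c.symm y)))) +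
          ρ (c.symm y) ^ q * (volDensity g c y * (Real.exp (u (c.symm y)) ^ (2 * mu + n * lam) *
            mvfderiv (𝓡 n) η (c.symm y) (grad g φ (c.symm y)))) := by
          rw [hξ, chartPull_apply hy]; ring
      _ = _ := by
          rw [exp_rpow_mul_rpow_weight, h1, h2, h3, Finset.mul_sum, Finset.mul_sum,
            Finset.mul_sum, ← Finset.sum_add_distrib, ← Finset.sum_add_distrib]
          exact Finset.sum_congr rfl fun i _ => by rw [hW]; ring
  have hzero : ∀ i, ∀ y ∉ c.target, q * ρ (c.symm y) ^ (q - 1) * lowerComp g c X i y *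
      (ξ y * W i y) + ρ (c.symm y) ^ q * fderiv ℝ (fun y => ξ y * W i y) y (e i) = 0 := by
    intro i y hy
    rw [image_eq_zero_of_notMem_tsupport fun h => hy (hts' h),
      image_eq_zero_of_notMem_tsupport (f := fderiv ℝ fun y => ξ y * W i y) fun h =>
        hy (hts' (tsupport_mul_subset_left (tsupport_fderiv_subset ℝ h)))]
    simp
  have i1 : IntegrableOn (fun y => volDensity g c y * (A (c.symm y) * η (c.symm y) +
      mvfderiv (𝓡 n) η (c.symm y) (Z (c.symm y)))) c.target :=
    ((integrable_finsetSum _ fun i _ => (key i).1).integrableOn).congr_fun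
      (fun y hy => (e1 y hy).symm) c.open_target.measurableSet
  have z1 : ∀ x ∉ c.source, A x * η x + mvfderiv (𝓡 n) η x (Z x) = 0 := fun x hx => by
    rw [image_eq_zero_of_notMem_tsupport fun h => hx (hηc h),
      mvfderiv_apply_of_notMem_tsupport fun h => hx (hηc h), mul_zero, add_zero]
  obtain ⟨j1, k1⟩ := integrable_and_integral_eq_chart g hc z1 i1
  refine ⟨j1, ?_⟩
  rw [k1, setIntegral_congr_fun c.open_target.measurableSet e1,
    setIntegral_eq_integral_of_forall_compl_eq_zero fun y hy =>
      Finset.sum_eq_zero fun i _ => hzero i y hy,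
    integral_finsetSum _ fun i _ => (key i).1]
  exact Finset.sum_eq_zero fun i _ => (key i).2

theorem integrable_mul_of_bounded {Ω K : Set (EuclideanSpace ℝ (Fin n))}
    (hK : IsCompact K) (hKΩ : K ⊆ Ω) {F ζ : EuclideanSpace ℝ (Fin n) → ℝ}
    (hF : AEStronglyMeasurable F (volume.restrict Ω)) {B : ℝ} (hB : ∀ᵐ y, y ∈ K → |F y| ≤ B)
    (hζ : Continuous ζ) (h0 : ∀ y ∉ K, ζ y = 0) : Integrable fun y => F y * ζ y := by
  have h2 : (K.indicator fun y => F y * ζ y) = fun y => F y * ζ y :=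
    indicator_eq_self.2 fun y hy => by
      by_contra hyK
      exact hy (by simp [h0 y hyK])
  rw [← h2, integrable_indicator_iff hK.measurableSet]
  refine Integrable.bdd_mul (c := B) (hζ.continuousOn.integrableOn_compact hK)
    (hF.mono_measure (Measure.restrict_mono hKΩ le_rfl)) ?_
  rw [ae_restrict_iff' hK.measurableSet]
  exact hB

/-- The differential inequality `Δ^D ρ ≥ H`, tested with `ρ ^ s * η`, with `η` supported in a
chart. -/
theorem integral_affineLaplacianGEOn_chart {g : Metric n M}
    (hc : c ∈ atlas (EuclideanSpace ℝ (Fin n)) M) {U : Set M} (hU : IsOpen U)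
    {u ρ H η : M → ℝ} (hu : ContMDiff (𝓡 n) 𝓘(ℝ, ℝ) ∞ u) (hH : ContinuousOn H U)
    (hpos : ∀ x ∈ U, 0 < ρ x) {X : (x : M) → TangentSpace (𝓡 n) x}
    (h : IsBoundedWeakGradientOn (c.target ∩ c.symm ⁻¹' U) (fun y => ρ (c.symm y))
      (lowerComp g c X)) {lam mu : ℝ} (hΔ : AffineLaplacianGEOn g u lam mu U X H)
    (hη : IsTestFunctionOn n U η) (hηc : tsupport η ⊆ c.source) (hη0 : ∀ x, 0 ≤ η x) (s : ℝ)
    {A A' : M → ℝ} {Z : (x : M) → TangentSpace (𝓡 n) x}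
    (hA : ∀ x, A x = H x * ρ x ^ s * Real.exp (u x) ^ ((n + 1) * lam + mu))
    (hA' : ∀ x, A' x = s * ρ x ^ (s - 1) * (Real.exp (u x) ^ (mu - lam) *
      g.inner x (X x) (X x)) * Real.exp (u x) ^ ((n + 1) * lam + mu))
    (hZ : ∀ x, Z x = (ρ x ^ s * Real.exp (u x) ^ (mu - lam) *
      Real.exp (u x) ^ ((n + 1) * lam + mu)) • X x) :
    Integrable (fun x => A x * η x) (riemannianVolume g) ∧
    Integrable (fun x => A' x * η x + mvfderiv (𝓡 n) η x (Z x)) (riemannianVolume g) ∧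
    ∫ x, A x * η x ∂riemannianVolume g ≤
      - ∫ x, (A' x * η x + mvfderiv (𝓡 n) η x (Z x)) ∂riemannianVolume g := by
  obtain ⟨hs, hcs, hts⟩ := contDiff_chartPull hc hη hηc
  set Ω := c.target ∩ c.symm ⁻¹' U with hΩdef
  have hΩ : IsOpen Ω := c.isOpen_inter_preimage_symm hU
  have hΩt : Ω ⊆ c.target := inter_subset_left
  have hucont : Continuous u := hu.continuous
  set w : EuclideanSpace ℝ (Fin n) → ℝ := fun y =>
    Real.exp (u (c.symm y)) ^ (2 * mu + n * lam) * volDensity g c y with hw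
  have hwc : ContinuousOn w Ω :=
    ((continuousOn_exp_rpow_chart c hucont _).mul (contDiffOn_volDensity g hc).continuousOn).mono
      hΩt
  obtain ⟨hYm, hYb⟩ := h.coordComp_bounded hc hΩ hΩt hwc
  set Y : Fin n → EuclideanSpace ℝ (Fin n) → ℝ := fun i y => w y * coordComp c X i y with hY
  set H' : EuclideanSpace ℝ (Fin n) → ℝ := fun y => volDensity g c y * (H (c.symm y) *
    Real.exp (u (c.symm y)) ^ ((n + 1) * lam + mu)) with hH'
  have hH'c : ContinuousOn H' Ω :=
    ((contDiffOn_volDensity g hc).continuousOn.mono hΩt).mul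
      ((hH.comp (c.continuousOn_symm.mono hΩt) fun y hy => hy.2).mul
        ((continuousOn_exp_rpow_chart c hucont _).mono hΩt))
  have hinner : ∀ {θ : M → ℝ}, MDifferentiable (𝓡 n) 𝓘(ℝ, ℝ) θ → ∀ y ∈ c.target,
      volDensity g c y * (Real.exp (u (c.symm y)) ^ (2 * mu + n * lam) *
        mvfderiv (𝓡 n) θ (c.symm y) (X (c.symm y))) =
      ∑ i, Y i y * fderiv ℝ (fun z => θ (c.symm z)) y (e i) := by
    intro θ hθ y hy
    rw [mvfderiv_eq_sum_coordComp hc hy (hθ _), Finset.mul_sum, Finset.mul_sum]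
    exact Finset.sum_congr rfl fun i _ => by rw [hY, hw]; ring
  -- The hypothesis on M, tested with the lift of `ψ`, becomes a Euclidean inequality ∑ ∂ᵢYⁱ ≥ H'
  -- whose flux carries the weight and the density.
  have hineq : ∀ ψ : EuclideanSpace ℝ (Fin n) → ℝ, ContDiff ℝ ∞ ψ → HasCompactSupport ψ →
      tsupport ψ ⊆ Ω → (∀ y, 0 ≤ ψ y) →
      ∫ y, H' y * ψ y ≤ - ∫ y, ∑ i, Y i y * fderiv ℝ ψ y (e i) := by
    intro ψ hψ hψc hψΩ hψ0
    have htest := isTestFunctionOn_chartLift hc hψ hψc hψΩ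
    have hψt : tsupport ψ ⊆ c.target := hψΩ.trans hΩt
    have hsub : tsupport (chartLift c ψ) ⊆ c.source :=
      (tsupport_chartLift_subset hψc hψt).trans (by
        rintro _ ⟨y, hy, rfl⟩
        exact c.map_target (hψt hy))
    have h0 := hΔ _ htest fun x => indicator_nonneg (fun x _ => hψ0 _) x
    have hzψ : ∀ y ∉ tsupport ψ, ψ y = 0 := fun y hy => image_eq_zero_of_notMem_tsupport hy
    have hzψ' : ∀ i, ∀ y ∉ tsupport ψ, fderiv ℝ ψ y (e i) = 0 := fun i y hy => by
      rw [image_eq_zero_of_notMem_tsupport fun h => hy (tsupport_fderiv_subset ℝ h), zero_apply]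
    obtain ⟨B, hB⟩ := IsCompact.exists_bound_of_continuousOn hψc (hH'c.mono hψΩ)
    obtain ⟨D, hD⟩ := hYb _ hψΩ hψc
    have i1 : Integrable fun y => H' y * ψ y :=
      integrable_mul_of_bounded hψc hψΩ (hH'c.aestronglyMeasurable hΩ.measurableSet)
        (Eventually.of_forall hB) hψ.continuous hzψ
    have i2 : Integrable fun y => ∑ i, Y i y * fderiv ℝ ψ y (e i) :=
      integrable_finsetSum _ fun i _ => integrable_mul_of_bounded hψc hψΩ (hYm i)
        (hD.mono fun y hy hyK => hy hyK i) (contDiff_fderiv_apply_const hψ (e i)).continuous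
        (hzψ' i)
    have e1 : ∀ y ∈ c.target, volDensity g c y * (H (c.symm y) * chartLift c ψ (c.symm y) *
        Real.exp (u (c.symm y)) ^ ((n + 1) * lam + mu)) = H' y * ψ y := fun y hy => by
      rw [chartLift_apply_symm hy, hH']; ring
    have e2 : ∀ y ∈ c.target, volDensity g c y * (g.inner (c.symm y)
        (grad g (chartLift c ψ) (c.symm y)) (affineScale u lam mu X (c.symm y)) *
        Real.exp (u (c.symm y)) ^ ((n + 1) * lam + mu)) =
        ∑ i, Y i y * fderiv ℝ ψ y (e i) := fun y hy => by
      rw [inner_grad, affineScale, map_smul, smul_eq_mul, mul_right_comm,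
        exp_rpow_mul_rpow_weight, hinner (htest.smooth.mdifferentiable (by simp)) y hy,
        fderiv_chartLift hy]
    have z1 : ∀ x ∉ c.source, H x * chartLift c ψ x *
        Real.exp (u x) ^ ((n + 1) * lam + mu) = 0 := fun x hx => by
      rw [image_eq_zero_of_notMem_tsupport fun h => hx (hsub h)]; ring
    have z2 : ∀ x ∉ c.source, g.inner x (grad g (chartLift c ψ) x) (affineScale u lam mu X x) *
        Real.exp (u x) ^ ((n + 1) * lam + mu) = 0 := fun x hx => by
      rw [inner_grad, mvfderiv_apply_of_notMem_tsupport fun h => hx (hsub h), zero_mul]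
    rw [(integrable_and_integral_eq_chart g hc z1 (i1.integrableOn.congr_fun
        (fun y hy => (e1 y hy).symm) c.open_target.measurableSet)).2,
      (integrable_and_integral_eq_chart g hc z2 (i2.integrableOn.congr_fun
        (fun y hy => (e2 y hy).symm) c.open_target.measurableSet)).2,
      setIntegral_congr_fun c.open_target.measurableSet e1,
      setIntegral_congr_fun c.open_target.measurableSet e2,
      setIntegral_eq_integral_of_forall_compl_eq_zero fun y hy => by
        rw [hzψ y fun h => hy (hψt h), mul_zero],
      setIntegral_eq_integral_of_forall_compl_eq_zero fun y hy => Finset.sum_eq_zero fun i _ => by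
        rw [hzψ' i y fun h => hy (hψt h), mul_zero]] at h0
    exact h0
  have hξ0 : ∀ y, 0 ≤ chartPull c η y := fun y => indicator_nonneg (fun y _ => hη0 _) y
  obtain ⟨k1, k2, k3⟩ := h.integral_test_rpow hΩ (fun y hy => hpos _ hy.2) s hH'c hYm hYb hineq
    hs hcs hts hξ0
  have hηd : MDifferentiable (𝓡 n) 𝓘(ℝ, ℝ) η := hη.smooth.mdifferentiable (by simp)
  set ξ := chartPull c η with hξ
  have hts' : tsupport ξ ⊆ c.target := hts.trans hΩt
  have hzξ : ∀ y ∉ c.target, ξ y = 0 := fun y hy =>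
    image_eq_zero_of_notMem_tsupport fun h => hy (hts' h)
  have hzξ' : ∀ i, ∀ y ∉ c.target, fderiv ℝ ξ y (e i) = 0 := fun i y hy => by
    rw [image_eq_zero_of_notMem_tsupport fun h => hy (hts' (tsupport_fderiv_subset ℝ h)),
      zero_apply]
  have e1 : ∀ y ∈ c.target, volDensity g c y * (A (c.symm y) * η (c.symm y)) =
      H' y * (ρ (c.symm y) ^ s * ξ y) := fun y hy => by
    rw [hA, hξ, chartPull_apply hy, hH']; ring
  have e2 : ∀ y ∈ c.target, volDensity g c y * (A' (c.symm y) * η (c.symm y) +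
      mvfderiv (𝓡 n) η (c.symm y) (Z (c.symm y))) =
      ∑ i, Y i y * (s * ρ (c.symm y) ^ (s - 1) * lowerComp g c X i y * ξ y +
        ρ (c.symm y) ^ s * fderiv ℝ ξ y (e i)) := fun y hy => by
    have h1 := hinner hηd y hy
    have h2 : volDensity g c y * (Real.exp (u (c.symm y)) ^ (2 * mu + n * lam) *
        g.inner (c.symm y) (X (c.symm y)) (X (c.symm y))) =
        ∑ i, Y i y * lowerComp g c X i y := by
      rw [inner_eq_sum_coordComp g hc hy, Finset.mul_sum, Finset.mul_sum]
      exact Finset.sum_congr rfl fun i _ => by rw [hY, hw]; ring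
    rw [hA', hZ, map_smul, smul_eq_mul, mul_assoc (ρ (c.symm y) ^ s), exp_rpow_mul_rpow_weight]
    calc _ = s * ρ (c.symm y) ^ (s - 1) * ξ y * (volDensity g c y *
            ((Real.exp (u (c.symm y)) ^ (mu - lam) *
              Real.exp (u (c.symm y)) ^ ((n + 1) * lam + mu)) *
            g.inner (c.symm y) (X (c.symm y)) (X (c.symm y)))) +
          ρ (c.symm y) ^ s * (volDensity g c y * (Real.exp (u (c.symm y)) ^ (2 * mu + n * lam) *
            mvfderiv (𝓡 n) η (c.symm y) (X (c.symm y)))) := by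
          rw [hξ, chartPull_apply hy]; ring
      _ = _ := by
          rw [exp_rpow_mul_rpow_weight, h1, h2, Finset.mul_sum, Finset.mul_sum,
            ← Finset.sum_add_distrib]
          exact Finset.sum_congr rfl fun i _ => by rw [hξ, fderiv_chartPull hy]; ring
  have z1 : ∀ x ∉ c.source, A x * η x = 0 := fun x hx => by
    rw [image_eq_zero_of_notMem_tsupport fun h => hx (hηc h), mul_zero]
  have z2 : ∀ x ∉ c.source, A' x * η x + mvfderiv (𝓡 n) η x (Z x) = 0 := fun x hx => by
    rw [image_eq_zero_of_notMem_tsupport fun h => hx (hηc h),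
      mvfderiv_apply_of_notMem_tsupport fun h => hx (hηc h), mul_zero, add_zero]
  obtain ⟨j1, l1⟩ := integrable_and_integral_eq_chart g hc z1 (k1.integrableOn.congr_fun
    (fun y hy => (e1 y hy).symm) c.open_target.measurableSet)
  obtain ⟨j2, l2⟩ := integrable_and_integral_eq_chart g hc z2 (k2.integrableOn.congr_fun
    (fun y hy => (e2 y hy).symm) c.open_target.measurableSet)
  refine ⟨j1, j2, ?_⟩
  rw [l1, l2, setIntegral_congr_fun c.open_target.measurableSet e1,
    setIntegral_congr_fun c.open_target.measurableSet e2,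
    setIntegral_eq_integral_of_forall_compl_eq_zero fun y hy => by
      rw [hzξ y hy, mul_zero, mul_zero],
    setIntegral_eq_integral_of_forall_compl_eq_zero fun y hy => Finset.sum_eq_zero fun i _ => by
      rw [hzξ y hy, hzξ' i y hy, mul_zero, mul_zero, add_zero, mul_zero]]
  exact k3

end LocalWeakForms

/-! ### Patching the weak forms together on M. -/

section GlobalWeakForms

open Filter Topology

set_option linter.unusedSectionVars false

variable {n : ℕ} {M : Type*} [TopologicalSpace M]
  [ChartedSpace (EuclideanSpace ℝ (Fin n)) M] [IsManifold (𝓡 n) ∞ M]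
  [T2Space M] [SigmaCompactSpace M] [MeasurableSpace M] [BorelSpace M]

theorem mvfderiv_finset_sum {ι : Type*} (S : Finset ι) {f : ι → M → ℝ}
    (hf : ∀ i ∈ S, MDifferentiable (𝓡 n) 𝓘(ℝ, ℝ) (f i)) (x : M) (v : TangentSpace (𝓡 n) x) :
    mvfderiv (𝓡 n) (fun x => ∑ i ∈ S, f i x) x v = ∑ i ∈ S, mvfderiv (𝓡 n) (f i) x v := by
  classical
  have key : MDifferentiable (𝓡 n) 𝓘(ℝ, ℝ) (fun x => ∑ i ∈ S, f i x) ∧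
      mvfderiv (𝓡 n) (fun x => ∑ i ∈ S, f i x) x v = ∑ i ∈ S, mvfderiv (𝓡 n) (f i) x v := by
    induction S using Finset.induction_on with
    | empty =>
      simp only [Finset.sum_empty]
      exact ⟨mdifferentiable_const, by rw [mvfderiv_const, zero_apply]⟩
    | insert a S ha ih =>
      obtain ⟨h1, h2⟩ := ih fun i hi => hf i (Finset.mem_insert_of_mem hi)
      have h3 := hf a (Finset.mem_insert_self a S)
      simp only [Finset.sum_insert ha]
      refine ⟨h3.add h1, ?_⟩
      rw [mvfderiv_fun_add (h3 x) (h1 x), add_apply, h2]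
  exact key.2

/-- A test function is a finite sum of test functions supported in chart domains. -/
theorem IsTestFunctionOn.exists_chart_decomposition {U : Set M} {η : M → ℝ}
    (hη : IsTestFunctionOn n U η) :
    ∃ (S : Finset M) (ζ : M → M → ℝ), (∀ p, IsTestFunctionOn n U (ζ p)) ∧
      (∀ p, tsupport (ζ p) ⊆ (chartAt (EuclideanSpace ℝ (Fin n)) p).source) ∧
      ((∀ x, 0 ≤ η x) → ∀ p x, 0 ≤ ζ p x) ∧ ∀ x, η x = ∑ p ∈ S, ζ p x := by
  have hfin := (chartPartition n M).locallyFinite.finite_nonempty_inter_compact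
    hη.compact_support
  refine ⟨hfin.toFinset, fun p x => chartPartition n M p x * η x, fun p => ⟨?_, ?_, ?_⟩,
    fun p => ?_, fun h0 p x => mul_nonneg ((chartPartition n M).nonneg p x) (h0 x), fun x => ?_⟩
  · exact (chartPartition n M p).contMDiff.mul hη.smooth
  · exact hη.compact_support.mul_left
  · exact tsupport_mul_subset_right.trans hη.support_subset
  · exact tsupport_mul_subset_left.trans (chartPartition_isSubordinate p)
  · rw [← Finset.sum_mul]
    by_cases hx : x ∈ tsupport η
    · have h1 := (chartPartition n M).sum_eq_one (mem_univ x)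
      rw [finsum_eq_sum_of_support_subset (s := hfin.toFinset) _ (fun p hp => by
        rw [Finite.coe_toFinset]
        exact ⟨x, hp, hx⟩)] at h1
      rw [h1, one_mul]
    · rw [image_eq_zero_of_notMem_tsupport hx, mul_zero]

/-- Summing over a chart decomposition of a test function. -/
theorem integral_eq_sum_of_decomposition {μ : Measure M} {U : Set M} {η : M → ℝ} {S : Finset M}
    {ζ : M → M → ℝ} (hζ : ∀ p, IsTestFunctionOn n U (ζ p)) (hsum : ∀ x, η x = ∑ p ∈ S, ζ p x)
    {A : M → ℝ} {Z : (x : M) → TangentSpace (𝓡 n) x}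
    (hint : ∀ p, Integrable (fun x => A x * ζ p x + mvfderiv (𝓡 n) (ζ p) x (Z x)) μ) :
    Integrable (fun x => A x * η x + mvfderiv (𝓡 n) η x (Z x)) μ ∧
      ∫ x, (A x * η x + mvfderiv (𝓡 n) η x (Z x)) ∂μ =
        ∑ p ∈ S, ∫ x, (A x * ζ p x + mvfderiv (𝓡 n) (ζ p) x (Z x)) ∂μ := by
  have hη : η = fun x => ∑ p ∈ S, ζ p x := funext hsum
  have h : ∀ x, A x * η x + mvfderiv (𝓡 n) η x (Z x) =
      ∑ p ∈ S, (A x * ζ p x + mvfderiv (𝓡 n) (ζ p) x (Z x)) := fun x => by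
    rw [Finset.sum_add_distrib, ← Finset.mul_sum, ← hsum, hη,
      mvfderiv_finset_sum S fun p _ => (hζ p).smooth.mdifferentiable (by simp)]
  simp only [h]
  exact ⟨integrable_finsetSum _ fun p _ => hint p, integral_finsetSum _ fun p _ => hint p⟩

variable {g : Metric n M} {U : Set M} {u ρ : M → ℝ} {lam mu : ℝ}
  {X : (x : M) → TangentSpace (𝓡 n) x}

/-- The total divergence of ρ^q η V^{τ+μ-λ} ∇φ integrates to zero. The identity is linear in `η`, so
the chart pieces add up; it serves with `q = α - 2` and `η = φ`. -/
theorem integral_affineLaplacian_test (hU : IsOpen U) (hu : ContMDiff (𝓡 n) 𝓘(ℝ, ℝ) ∞ u)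
    (hρ : Continuous ρ) (hpos : ∀ x ∈ U, 0 < ρ x) (hX : IsWeakGradientOn g U ρ X)
    (hX_norm : ∀ᵐ x ∂((riemannianVolume g).restrict U), norm g x (affineScale u lam mu X x) = 1)
    {φ η : M → ℝ} (hφ : ContMDiff (𝓡 n) 𝓘(ℝ, ℝ) ∞ φ) (hη : IsTestFunctionOn n U η) (q : ℝ) :
    Integrable (fun x => (ρ x ^ q * affineLaplacian g u lam mu φ x + q * ρ x ^ (q - 1) *
      (Real.exp (u x) ^ (mu - lam) * g.inner x (X x) (grad g φ x))) *
        Real.exp (u x) ^ ((n + 1) * lam + mu) * η x +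
      mvfderiv (𝓡 n) η x ((ρ x ^ q * Real.exp (u x) ^ (mu - lam) *
        Real.exp (u x) ^ ((n + 1) * lam + mu)) • grad g φ x)) (riemannianVolume g) ∧
    ∫ x, ((ρ x ^ q * affineLaplacian g u lam mu φ x + q * ρ x ^ (q - 1) *
      (Real.exp (u x) ^ (mu - lam) * g.inner x (X x) (grad g φ x))) *
        Real.exp (u x) ^ ((n + 1) * lam + mu) * η x +
      mvfderiv (𝓡 n) η x ((ρ x ^ q * Real.exp (u x) ^ (mu - lam) *
        Real.exp (u x) ^ ((n + 1) * lam + mu)) • grad g φ x)) ∂riemannianVolume g = 0 := by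
  obtain ⟨S, ζ, hζ, hζs, -, hsum⟩ := hη.exists_chart_decomposition
  have hloc := fun p => integral_affineLaplacian_chart (chart_mem_atlas _ p) hU hu hφ hpos
    (hX.isBoundedWeakGradientOn hU hu.continuous hρ hX_norm rfl) (hζ p) (hζs p) lam mu q
    (fun _ => rfl) (fun _ => rfl)
  obtain ⟨h1, h2⟩ := integral_eq_sum_of_decomposition hζ hsum fun p => (hloc p).1
  exact ⟨h1, h2.trans (Finset.sum_eq_zero fun p _ => (hloc p).2)⟩

/-- The partition of unity is nonnegative, so each piece of `η` is an admissible test function and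
the local inequalities add up. It serves with `s = α - 3` and `η = φ²`. -/
theorem integral_affineLaplacianGEOn_test (hU : IsOpen U) (hu : ContMDiff (𝓡 n) 𝓘(ℝ, ℝ) ∞ u)
    (hρ : Continuous ρ) (hpos : ∀ x ∈ U, 0 < ρ x) (hX : IsWeakGradientOn g U ρ X)
    (hX_norm : ∀ᵐ x ∂((riemannianVolume g).restrict U), norm g x (affineScale u lam mu X x) = 1)
    {H : M → ℝ} (hH : ContinuousOn H U) (hΔ : AffineLaplacianGEOn g u lam mu U X H)
    {η : M → ℝ} (hη : IsTestFunctionOn n U η) (hη0 : ∀ x, 0 ≤ η x) (s : ℝ) :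
    Integrable (fun x => s * ρ x ^ (s - 1) * (Real.exp (u x) ^ (mu - lam) *
        g.inner x (X x) (X x)) * Real.exp (u x) ^ ((n + 1) * lam + mu) * η x +
      mvfderiv (𝓡 n) η x ((ρ x ^ s * Real.exp (u x) ^ (mu - lam) *
        Real.exp (u x) ^ ((n + 1) * lam + mu)) • X x)) (riemannianVolume g) ∧
    ∫ x, H x * ρ x ^ s * Real.exp (u x) ^ ((n + 1) * lam + mu) * η x ∂riemannianVolume g ≤
      - ∫ x, (s * ρ x ^ (s - 1) * (Real.exp (u x) ^ (mu - lam) *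
        g.inner x (X x) (X x)) * Real.exp (u x) ^ ((n + 1) * lam + mu) * η x +
      mvfderiv (𝓡 n) η x ((ρ x ^ s * Real.exp (u x) ^ (mu - lam) *
        Real.exp (u x) ^ ((n + 1) * lam + mu)) • X x)) ∂riemannianVolume g := by
  obtain ⟨S, ζ, hζ, hζs, hζ0, hsum⟩ := hη.exists_chart_decomposition
  have hloc := fun p => integral_affineLaplacianGEOn_chart (chart_mem_atlas _ p) hU hu hH hpos
    (hX.isBoundedWeakGradientOn hU hu.continuous hρ hX_norm rfl) hΔ (hζ p) (hζs p) (hζ0 hη0 p) s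
    (fun _ => rfl) (fun _ => rfl) (fun _ => rfl)
  -- With a zero vector field the decomposition lemma also covers the side that contains no
  -- derivative of `η`.
  obtain ⟨-, h2⟩ := integral_eq_sum_of_decomposition (μ := riemannianVolume g) hζ hsum
    (A := fun x => H x * ρ x ^ s * Real.exp (u x) ^ ((n + 1) * lam + mu)) (Z := fun _ => 0)
    fun p => by simpa using (hloc p).1
  obtain ⟨h3, h4⟩ := integral_eq_sum_of_decomposition hζ hsum fun p => (hloc p).2.1
  simp only [map_zero, add_zero] at h2
  refine ⟨h3, ?_⟩
  rw [h2, h4, ← Finset.sum_neg_distrib]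
  exact Finset.sum_le_sum fun p _ => (hloc p).2.2

theorem continuous_inner_grad (g : Metric n M) {f φ : M → ℝ}
    (hf : ContMDiff (𝓡 n) 𝓘(ℝ, ℝ) ∞ f) (hφ : ContMDiff (𝓡 n) 𝓘(ℝ, ℝ) ∞ φ) :
    Continuous fun x => g.inner x (grad g f x) (grad g φ x) := by
  refine continuous_iff_continuousAt.2 fun x => ?_
  set c := chartAt (EuclideanSpace ℝ (Fin n)) x with hcdef
  have hc : c ∈ atlas (EuclideanSpace ℝ (Fin n)) M := chart_mem_atlas _ x
  have hs := c.open_source.mem_nhds (mem_chart_source _ x)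
  have h1 : ContinuousOn (fun y => ∑ i, coordComp c (grad g φ) i y *
      fderiv ℝ (fun z => f (c.symm z)) y (e i)) c.target :=
    continuousOn_finsetSum _ fun i _ => (contDiffOn_coordComp_grad g hc hφ i).continuousOn.mul
      (contDiffOn_fderiv_apply c.open_target (contDiffOn_comp_symm hc hf) (e i)).continuousOn
  refine ((h1.comp c.continuousOn c.mapsTo).continuousAt hs).congr ?_
  filter_upwards [hs] with z hz
  have h2 := mvfderiv_eq_sum_coordComp hc (c.map_source hz)
    (hf.mdifferentiableAt (by simp)) (grad g φ)
  rw [Function.comp_apply, ← h2, c.left_inv hz, inner_grad]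

theorem continuous_affineLaplacian (g : Metric n M) (hu : ContMDiff (𝓡 n) 𝓘(ℝ, ℝ) ∞ u)
    (lam mu : ℝ) {φ : M → ℝ} (hφ : ContMDiff (𝓡 n) 𝓘(ℝ, ℝ) ∞ φ) :
    Continuous (affineLaplacian g u lam mu φ) :=
  (hu.continuous.rexp.rpow_const fun _ => Or.inl (Real.exp_ne_zero _)).mul
    ((continuous_div g (smoothComponents_grad g hφ)).add
      (continuous_const.mul (continuous_inner_grad g hu hφ)))

theorem grad_of_notMem_tsupport (g : Metric n M) {φ : M → ℝ} {x : M} (hx : x ∉ tsupport φ) :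
    grad g φ x = 0 := by
  by_contra h
  refine (g.pos x _ h).ne' ?_
  rw [inner_grad, mvfderiv_apply_of_notMem_tsupport hx]

/-- Locality confines the integrands to the support of φ, away from the zeros of ρ, where the powers
of ρ may be singular. -/
theorem affineLaplacian_of_notMem_tsupport (g : Metric n M) (u : M → ℝ) (lam mu : ℝ)
    {φ : M → ℝ} {x : M} (hx : x ∉ tsupport φ) : affineLaplacian g u lam mu φ x = 0 := by
  set c := chartAt (EuclideanSpace ℝ (Fin n)) x with hcdef
  have hcx : c x ∈ c.target := c.map_source (mem_chart_source _ x)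
  have hO : c.target ∩ c.symm ⁻¹' (tsupport φ)ᶜ ∈ 𝓝 (c x) :=
    (c.isOpen_inter_preimage_symm (isClosed_tsupport φ).isOpen_compl).mem_nhds
      ⟨hcx, by rwa [mem_preimage, c.left_inv (mem_chart_source _ x)]⟩
  have h1 : ∀ i, fderiv ℝ (fun y => volDensity g c y * coordComp c (grad g φ) i y) (c x) = 0 := by
    intro i
    have : (fun y => volDensity g c y * coordComp c (grad g φ) i y) =ᶠ[𝓝 (c x)] fun _ => 0 := by
      filter_upwards [hO] with y hy
      rw [coordComp, grad_of_notMem_tsupport g hy.2, map_zero, PiLp.zero_apply, mul_zero]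
    rw [this.fderiv_eq, fderiv_fun_const]
    rfl
  have h2 : laplacian g φ x = 0 := by
    rw [laplacian, div]
    simp only [← hcdef, h1, zero_apply, Finset.sum_const_zero, mul_zero]
  rw [affineLaplacian, h2, grad_of_notMem_tsupport g hx, map_zero, mul_zero, add_zero, mul_zero]

/-- Meant for weights such as ρ^q, continuous only off the zeros of ρ: the support of `ζ` avoids
these, so the product is continuous on all of M. -/
theorem integrable_mul_of_continuousOn {μ : Measure M} [IsFiniteMeasureOnCompacts μ]
    (hU : IsOpen U) {f ζ : M → ℝ} (hf : ContinuousOn f U) (hζ : Continuous ζ)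
    (hζc : HasCompactSupport ζ) (hζU : tsupport ζ ⊆ U) : Integrable (fun x => f x * ζ x) μ := by
  have hcont : Continuous fun x => f x * ζ x := continuous_of_tsupport fun x hx =>
    (hf.continuousAt (hU.mem_nhds (hζU (tsupport_mul_subset_right hx)))).mul hζ.continuousAt
  exact hcont.integrable_of_hasCompactSupport hζc.mul_left

end GlobalWeakForms

/-! ### The two completed squares. -/

section Rellich

/-- The quadratic form behind the Hardy inequality is pointwise nonnegative. -/
theorem hardy_pointwise {n : ℕ} {M : Type*} [TopologicalSpace M]
    [ChartedSpace (EuclideanSpace ℝ (Fin n)) M] [IsManifold (𝓡 n) ∞ M]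
    [T2Space M] [SigmaCompactSpace M] [MeasurableSpace M] [BorelSpace M]
    (g : Metric n M) (x : M) (v w : TangentSpace (𝓡 n) x) (r t κ α : ℝ) (hr : 0 < r) :
    0 ≤ r ^ (α - 2) * g.inner x w w + 2 * κ * (r ^ (α - 3) * t * g.inner x v w) +
      κ ^ 2 * (r ^ (α - 4) * t ^ 2 * g.inner x v v) := by
  -- Here `v`, `w`, `t` stand for ∇ρ, ∇φ, φ; the claim is the squared length of this vector times `r
  -- ^ (α - 4)`.
  have h := inner_self_nonneg g x (r • w + (κ * t) • v)
  simp only [map_add, map_smul, add_apply, smul_apply, smul_eq_mul] at h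
  rw [g.symm x w v] at h
  have e1 : r ^ (α - 3) = r ^ (α - 4) * r := by
    rw [← Real.rpow_add_one hr.ne']; congr 1; ring
  have e2 : r ^ (α - 2) = r ^ (α - 4) * r ^ 2 := by
    rw [← Real.rpow_add_natCast hr.ne']; congr 1; push_cast; ring
  have h2 := mul_nonneg (Real.rpow_nonneg hr.le (α - 4)) h
  rw [e1, e2]
  linarith

/-- Expand `r ^ (α - 4) * a * (r ^ 2 * l + θ * t * b) ^ 2` with `a * b = 1`. In the application `l`
is Δ^Dφ, and `a`, `b` are V^{μ-λ} and V^{λ-μ}. -/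
theorem rellich_pointwise (r t l a b θ α : ℝ) (hr : 0 < r) (ha : 0 < a) (hab : b = a⁻¹) :
    0 ≤ r ^ α * l ^ 2 * a + 2 * θ * (r ^ (α - 2) * t * l) + θ ^ 2 * (r ^ (α - 4) * t ^ 2 * b) := by
  have e1 : r ^ α = r ^ (α - 4) * r ^ 4 := by
    rw [← Real.rpow_add_natCast hr.ne']; congr 1; push_cast; ring
  have e2 : r ^ (α - 2) = r ^ (α - 4) * r ^ 2 := by
    rw [← Real.rpow_add_natCast hr.ne']; congr 1; push_cast; ring
  have h2 := mul_nonneg (mul_nonneg (Real.rpow_nonneg hr.le (α - 4)) ha.le)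
    (sq_nonneg (r ^ 2 * l + θ * t * b))
  have e3 : a * b = 1 := by rw [hab, mul_inv_cancel₀ ha.ne']
  have e4 : r ^ (α - 4) * a * (r ^ 2 * l + θ * t * b) ^ 2 = r ^ (α - 4) * r ^ 4 * l ^ 2 * a +
      2 * θ * (r ^ (α - 4) * r ^ 2 * t * l) * (a * b) +
      θ ^ 2 * (r ^ (α - 4) * t ^ 2 * b) * (a * b) := by ring
  rw [e1, e2]
  rw [e4, e3] at h2
  linarith

end Rellich

end AffineRellich

end

/-! ### Combining the weak forms with the squares. -/

theorem mainTheorem4 (n : ℕ) {M : Type*} [TopologicalSpace M] [T2Space M] [SigmaCompactSpace M]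
    [ChartedSpace (EuclideanSpace ℝ (Fin n)) M] [IsManifold (𝓡 n) ∞ M]
    [MeasurableSpace M] [BorelSpace M]
    (g : AffineRellich.Metric n M)
    (u : M → ℝ) (hu : ContMDiff (𝓡 n) 𝓘(ℝ, ℝ) ∞ u)
    (lam mu tau : ℝ) (htau : tau = (n + 1) * lam + mu)
    (C α : ℝ) (hC : 1 < C) (hα : α < 2) (hCα : 0 < C + α - 3)
    (ρ : M → ℝ) (hρ : Continuous ρ) (hρ_nonneg : ∀ x, 0 ≤ ρ x)
    (U : Set M) (hU : U = (ρ ⁻¹' {0})ᶜ)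
    (X : (x : M) → TangentSpace (𝓡 n) x)
    (hX : AffineRellich.IsWeakGradientOn g U ρ X)
    (hX_norm : ∀ᵐ x ∂((AffineRellich.riemannianVolume g).restrict U),
      AffineRellich.norm g x (AffineRellich.affineScale u lam mu X x) = 1)
    (hΔ : AffineRellich.AffineLaplacianGEOn g u lam mu U X
      (fun x => C / ρ x * Real.exp (u x) ^ (lam - mu)))
    (φ : M → ℝ) (hφ : AffineRellich.IsTestFunctionOn n U φ) :
    (C + α - 3) ^ 2 * (C - α + 1) ^ 2 / 16 *
        ∫ x, ρ x ^ (α - 4) * φ x ^ 2 * Real.exp (u x) ^ (tau + lam - mu)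
          ∂(AffineRellich.riemannianVolume g) ≤
      ∫ x, ρ x ^ α * AffineRellich.affineLaplacian g u lam mu φ x ^ 2 *
          Real.exp (u x) ^ (tau + mu - lam) ∂(AffineRellich.riemannianVolume g) := by
  open AffineRellich in
  have hUo : IsOpen U := by
    rw [hU]
    exact (isClosed_singleton.preimage hρ).isOpen_compl
  have hpos : ∀ x ∈ U, 0 < ρ x := fun x hx => by
    rw [hU] at hx
    exact lt_of_le_of_ne (hρ_nonneg x) fun h => hx h.symm
  set V : ℝ → M → ℝ := fun t x => Real.exp (u x) ^ t with hV
  have hVc : ∀ t, Continuous (V t) := fun t =>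
    hu.continuous.rexp.rpow_const fun _ => Or.inl (Real.exp_ne_zero _)
  have hVpos : ∀ t x, 0 < V t x := fun t x => Real.rpow_pos_of_pos (Real.exp_pos _) t
  have hVadd : ∀ s t x, V s x * V t x = V (s + t) x := fun s t x => exp_rpow_mul_exp_rpow _ _ _
  have hρp : ∀ q : ℝ, ContinuousOn (fun x => ρ x ^ q) U := fun q =>
    hρ.continuousOn.rpow_const fun x hx => Or.inl (hpos x hx).ne'
  have hφ0 : ∀ x ∉ U, φ x = 0 := fun x hx =>
    image_eq_zero_of_notMem_tsupport fun h => hx (hφ.support_subset h)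
  have hφd : MDifferentiable (𝓡 n) 𝓘(ℝ, ℝ) φ := hφ.smooth.mdifferentiable (by simp)
  have hφ2 : IsTestFunctionOn n U fun x => φ x ^ 2 := by
    refine ⟨hφ.smooth.pow 2, ?_, ?_⟩
    · have : (fun x => φ x ^ 2) = fun x => φ x * φ x := funext fun x => sq _
      rw [this]
      exact hφ.compact_support.mul_left
    · have : (fun x => φ x ^ 2) = fun x => φ x * φ x := funext fun x => sq _
      rw [this]
      exact tsupport_mul_subset_left.trans hφ.support_subset
  have hdφ2 : ∀ x (v : TangentSpace (𝓡 n) x), mvfderiv (𝓡 n) (fun x => φ x ^ 2) x v =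
      2 * φ x * mvfderiv (𝓡 n) φ x v := fun x v => by
    have : (fun x => φ x ^ 2) = fun x => φ x * φ x := funext fun x => sq _
    rw [this, mvfderiv_fun_mul (hφd x) (hφd x)]
    simp only [add_apply, smul_apply, smul_eq_mul]
    ring
  have hLc : Continuous (affineLaplacian g u lam mu φ) :=
    continuous_affineLaplacian g hu lam mu hφ.smooth
  have hLs : tsupport (affineLaplacian g u lam mu φ) ⊆ tsupport φ := by
    refine closure_minimal (fun x hx => ?_) (isClosed_tsupport φ)
    by_contra h
    exact hx (affineLaplacian_of_notMem_tsupport g u lam mu h)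
  set L := affineLaplacian g u lam mu φ with hL
  set P : M → ℝ := fun x => ρ x ^ (α - 4) * φ x ^ 2 * V (tau + lam - mu) x with hP
  set E : M → ℝ := fun x => ρ x ^ (α - 3) * φ x * g.inner x (X x) (grad g φ x) *
    V (tau + mu - lam) x with hE
  set B : M → ℝ := fun x => ρ x ^ (α - 2) * g.inner x (grad g φ x) (grad g φ x) *
    V (tau + mu - lam) x with hB
  set F : M → ℝ := fun x => ρ x ^ (α - 2) * φ x * L x * V tau x with hF
  set D : M → ℝ := fun x => ρ x ^ α * L x ^ 2 * V (tau + mu - lam) x with hD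
  have hPint : Integrable P (riemannianVolume g) := by
    have := integrable_mul_of_continuousOn (μ := riemannianVolume g) hUo
      ((hρp (α - 4)).mul (hVc (tau + lam - mu)).continuousOn) hφ2.smooth.continuous
      hφ2.compact_support hφ2.support_subset
    refine this.congr (Filter.Eventually.of_forall fun x => ?_)
    simp only [hP, Pi.mul_apply]; ring
  have hFint : Integrable F (riemannianVolume g) := by
    have := integrable_mul_of_continuousOn (μ := riemannianVolume g) hUo
      (((hρp (α - 2)).mul hLc.continuousOn).mul (hVc tau).continuousOn) hφ.smooth.continuous
      hφ.compact_support hφ.support_subset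
    refine this.congr (Filter.Eventually.of_forall fun x => ?_)
    simp only [hF, Pi.mul_apply]; ring
  have hDint : Integrable D (riemannianVolume g) := by
    have := integrable_mul_of_continuousOn (μ := riemannianVolume g) hUo
      (((hρp α).mul hLc.continuousOn).mul (hVc (tau + mu - lam)).continuousOn) hLc
      (hφ.compact_support.of_isClosed_subset (isClosed_tsupport _) hLs)
      (hLs.trans hφ.support_subset)
    refine this.congr (Filter.Eventually.of_forall fun x => ?_)
    simp only [hD, Pi.mul_apply]; ring
  have hnorm : ∀ᵐ x ∂riemannianVolume g, x ∈ U →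
      V (mu - lam) x * g.inner x (X x) (X x) = V (lam - mu) x := by
    rw [ae_restrict_iff' hUo.measurableSet] at hX_norm
    filter_upwards [hX_norm] with x hx hxU
    exact mul_inner_self_of_norm_affineScale g (hx hxU)
  have ht1 : ∀ x, V (mu - lam) x * V ((n + 1) * lam + mu) x = V (tau + mu - lam) x := fun x => by
    rw [hVadd, htau]; congr 1; ring
  have ht2 : ∀ x, V (lam - mu) x * V ((n + 1) * lam + mu) x = V (tau + lam - mu) x := fun x => by
    rw [hVadd, htau]; congr 1; ring
  -- The exponent α-3 makes both C/ρ times the power and the derivative of the power multiples of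
  -- ρ^{α-4}, the weight in `P`.
  obtain ⟨i1, j1⟩ := integral_affineLaplacianGEOn_test hUo hu hρ hpos hX hX_norm
    ((continuousOn_const.div hρ.continuousOn fun x hx => (hpos x hx).ne').mul
      (hVc (lam - mu)).continuousOn) hΔ hφ2 (fun x => sq_nonneg _) (α - 3)
  obtain ⟨i2, j2⟩ := integral_affineLaplacian_test hUo hu hρ hpos hX hX_norm hφ.smooth hφ (α - 2)
  have a1 : ∀ x, C / ρ x * V (lam - mu) x * ρ x ^ (α - 3) * V ((n + 1) * lam + mu) x * φ x ^ 2 =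
      C * P x := fun x => by
    by_cases hx : x ∈ U
    · have : ρ x ^ (α - 3) = ρ x ^ (α - 4) * ρ x := by
        rw [← Real.rpow_add_one (hpos x hx).ne']; congr 1; ring
      simp only [hP]
      rw [this, ← ht2]
      have := (hpos x hx).ne'
      field_simp
    · simp [hP, hφ0 x hx]
  have a2 : (fun x => (α - 3) * ρ x ^ (α - 3 - 1) * (V (mu - lam) x *
        g.inner x (X x) (X x)) * V ((n + 1) * lam + mu) x * φ x ^ 2 +
      mvfderiv (𝓡 n) (fun x => φ x ^ 2) x ((ρ x ^ (α - 3) * V (mu - lam) x *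
        V ((n + 1) * lam + mu) x) • X x)) =ᵐ[riemannianVolume g]
      fun x => (α - 3) * P x + 2 * E x := by
    filter_upwards [hnorm] with x hx
    rw [hdφ2]
    by_cases hxU : x ∈ U
    · rw [hx hxU, map_smul, smul_eq_mul, ← inner_grad g φ, g.symm x (grad g φ x),
        mul_assoc (ρ x ^ (α - 3)), ht1, show α - 3 - 1 = α - 4 by ring]
      simp only [hP, hE]
      rw [← ht2]
      ring
    · simp [hP, hE, hφ0 x hxU]
  have a3 : ∀ x, (ρ x ^ (α - 2) * L x + (α - 2) * ρ x ^ (α - 2 - 1) * (V (mu - lam) x *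
        g.inner x (X x) (grad g φ x))) * V ((n + 1) * lam + mu) x * φ x +
      mvfderiv (𝓡 n) φ x ((ρ x ^ (α - 2) * V (mu - lam) x *
        V ((n + 1) * lam + mu) x) • grad g φ x) = F x + (α - 2) * E x + B x := fun x => by
    rw [map_smul, smul_eq_mul, ← inner_grad g φ, mul_assoc (ρ x ^ (α - 2)), ht1,
      show α - 2 - 1 = α - 3 by ring]
    simp only [hF, hE, hB]
    rw [← ht1, htau]
    ring
  have i1' := i1.congr a2
  -- `E` contains the weak gradient, so continuity cannot give its integrability; it is what remains
  -- of the integrable expression `i1'` after removing `P`.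
  have hEint : Integrable E (riemannianVolume g) := by
    have := (i1'.sub (hPint.const_mul (α - 3))).const_mul (1 / 2)
    refine this.congr (Filter.Eventually.of_forall fun x => ?_)
    simp only [Pi.sub_apply]; ring
  have i2' : Integrable (fun x => F x + (α - 2) * E x + B x) (riemannianVolume g) :=
    i2.congr (Filter.Eventually.of_forall a3)
  have hBint : Integrable B (riemannianVolume g) := by
    have := (i2'.sub hFint).sub (hEint.const_mul (α - 2))
    refine this.congr (Filter.Eventually.of_forall fun x => ?_)
    simp only [Pi.sub_apply]; ring
  have k1 : C * ∫ x, P x ∂riemannianVolume g ≤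
      -((α - 3) * ∫ x, P x ∂riemannianVolume g + 2 * ∫ x, E x ∂riemannianVolume g) := by
    have h1 := integral_congr_ae a2
    rw [integral_add (hPint.const_mul _) (hEint.const_mul _), integral_const_mul,
      integral_const_mul] at h1
    rw [← h1, ← integral_const_mul]
    simp only [← a1]
    exact j1
  have k2 : ∫ x, F x ∂riemannianVolume g + (α - 2) * ∫ x, E x ∂riemannianVolume g +
      ∫ x, B x ∂riemannianVolume g = 0 := by
    have h1 : Integrable (fun x => F x + (α - 2) * E x) (riemannianVolume g) :=
      hFint.add (hEint.const_mul _)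
    rw [← integral_const_mul, ← integral_add hFint (hEint.const_mul _),
      ← integral_add h1 hBint, ← j2]
    exact integral_congr_ae (Filter.Eventually.of_forall fun x => (a3 x).symm)
  -- `k1` reads κP ≤ -E, and t = κ maximises the Hardy gain 2tκ - t². The choice of θ follows the
  -- same rule for the second square, whose input is θP ≤ -F.
  set κ : ℝ := (C + α - 3) / 2 with hκ
  set θ : ℝ := κ * (κ + 2 - α) with hθ
  have k3 : 0 ≤ ∫ x, B x ∂riemannianVolume g + 2 * κ * ∫ x, E x ∂riemannianVolume g +
      κ ^ 2 * ∫ x, P x ∂riemannianVolume g := by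
    have h0 : Integrable (fun x => B x + 2 * κ * E x) (riemannianVolume g) :=
      hBint.add (hEint.const_mul _)
    rw [← integral_const_mul, ← integral_const_mul, ← integral_add hBint (hEint.const_mul _),
      ← integral_add h0 (hPint.const_mul _)]
    refine integral_nonneg_of_ae ?_
    filter_upwards [hnorm] with x hx
    by_cases hxU : x ∈ U
    · have h1 := mul_nonneg (hardy_pointwise g x (X x) (grad g φ x) (ρ x) (φ x) κ α (hpos x hxU))
        (hVpos (tau + mu - lam) x).le
      have h2 : V (tau + lam - mu) x = g.inner x (X x) (X x) * V (tau + mu - lam) x := by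
        rw [← ht2, ← hx hxU, ← ht1]; ring
      simp only [Pi.zero_apply, hB, hE, hP]
      rw [h2]
      linarith
    · have h0 : grad g φ x = 0 :=
        grad_of_notMem_tsupport g fun h => hxU (hφ.support_subset h)
      simp [hB, hE, hP, h0, hφ0 x hxU]
  have k4 : 0 ≤ ∫ x, D x ∂riemannianVolume g + 2 * θ * ∫ x, F x ∂riemannianVolume g +
      θ ^ 2 * ∫ x, P x ∂riemannianVolume g := by
    have h0 : Integrable (fun x => D x + 2 * θ * F x) (riemannianVolume g) :=
      hDint.add (hFint.const_mul _)
    rw [← integral_const_mul, ← integral_const_mul, ← integral_add hDint (hFint.const_mul _),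
      ← integral_add h0 (hPint.const_mul _)]
    refine integral_nonneg fun x => ?_
    by_cases hxU : x ∈ U
    · have h3 : V (lam - mu) x = (V (mu - lam) x)⁻¹ := by
        refine eq_inv_of_mul_eq_one_left ?_
        rw [hVadd]
        simp [hV]
      have h1 := mul_nonneg (rellich_pointwise (ρ x) (φ x) (L x) (V (mu - lam) x)
        (V (lam - mu) x) θ α (hpos x hxU) (hVpos _ x) h3) (hVpos ((n + 1) * lam + mu) x).le
      simp only [Pi.zero_apply, hD, hF, hP]
      rw [← ht1, ← ht2, htau]
      linarith
    · have h0 : L x = 0 := affineLaplacian_of_notMem_tsupport g u lam mu fun h =>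
        hxU (hφ.support_subset h)
      simp [hD, hF, hP, h0, hφ0 x hxU]
  set IP := ∫ x, P x ∂riemannianVolume g
  set IE := ∫ x, E x ∂riemannianVolume g
  set IB := ∫ x, B x ∂riemannianVolume g
  set IF := ∫ x, F x ∂riemannianVolume g
  set ID := ∫ x, D x ∂riemannianVolume g
  have hκ0 : 0 < κ := by rw [hκ]; linarith
  have hθ0 : 0 < θ := mul_pos hκ0 (by linarith)
  have m1 : κ * IP ≤ -IE := by rw [hκ]; linarith
  have m2 : κ ^ 2 * IP ≤ IB := by
    have := mul_le_mul_of_nonneg_left m1 hκ0.le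
    nlinarith
  -- By `k2`, -F = B + (2-α)(-E); as 2-α ≥ 0, `m1` and `m2` give κ² + (2-α)κ = θ times P.
  have m3 : θ * IP ≤ -IF := by
    have := mul_le_mul_of_nonneg_left m1 (by linarith : (0 : ℝ) ≤ 2 - α)
    rw [hθ]
    nlinarith
  have m4 : θ ^ 2 * IP ≤ ID := by
    have := mul_le_mul_of_nonneg_left m3 hθ0.le
    nlinarith
  have hconst : (C + α - 3) ^ 2 * (C - α + 1) ^ 2 / 16 = θ ^ 2 := by
    rw [hθ, hκ]; ring
  rw [hconst]
  exact m4
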